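/- **Proposition (existence of the tri-moment map when $b_1(M)=0$).** Let $M$ be a smooth manifold of dimension $4m$, without boundary, and let $\psi$ be a $4$-plectic form on $M$, i.e. a smooth closed $4$-form such that for every $p\in M$ the map $v\mapsto\iota_v\psi_p$ on $T_pM$ has trivial kernel. Let $Sp(1)^k$ act smoothly on $M$, and for $X\in\mathfrak{sp}(1)^k$ let $\widehat X_p=\frac{d}{dt}\big|_{t=0}\exp(tX)\cdot p$ be its fundamental vector field. Suppose that the action is generalized Hamiltonian: it preserves $\psi$, and for every $X\in\mathfrak{sp}(1)^k$ the $3$-form $\iota_{\widehat X}\psi=\psi(\widehat X,\cdot,\cdot,\cdot)$ is exact. If $b_1(M)=\dim H^1_{dR}(M)=0$, then the action admits a tri-moment map, i.e. there is a smooth map $$\sigma:M\to\big((\Lambda^3\mathfrak{sp}(1))^k\big)^*\cong\mathbb R^k$$ such that 1. $\sigma(g\cdot p)=\sigma(p)$ for all $g\in Sp(1)^k$ and $p\in M$; 2. for every $\delta=(U_1\wedge V_1\wedge W_1,\dots,U_k\wedge V_k\wedge W_k)\in(\Lambda^3\mathfrak{sp}(1))^k$, $p\in M$ and $v\in T_pM$,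 $$d\sigma_p(v)(\delta)=\sum_{i=1}^k\psi_p\big((\widehat{U_i})_p,(\widehat{V_i})_p,(\widehat{W_i})_p,v\big),$$ where $U_i,V_i,W_i\in\mathfrak{sp}(1)$ are regarded as elements of the $i$-th summand of $\mathfrak{sp}(1)^k$. -/

import Mathlib

open scoped Manifold ContDiff Quaternion Topology

noncomputable section

/-! ### Differential forms on a smooth manifold without boundary -/

section Forms

variable {d : ℕ} {M : Type*} [TopologicalSpace M] [ChartedSpace (EuclideanSpace ℝ (Fin d)) M]

variable (d M) in
/-- Not necessarily smooth differential `n`-forms on a `d`-dimensional manifold `M`. -/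
def DiffForm (n : ℕ) : Type _ := ∀ p : M, TangentSpace (𝓡 d) p [⋀^Fin n]→L[ℝ] ℝ

instance DiffForm.instAddCommGroup (n : ℕ) : AddCommGroup (DiffForm d M n) :=
  inferInstanceAs (AddCommGroup (∀ p : M, TangentSpace (𝓡 d) p [⋀^Fin n]→L[ℝ] ℝ))

instance DiffForm.instModule (n : ℕ) : Module ℝ (DiffForm d M n) :=
  inferInstanceAs (Module ℝ (∀ p : M, TangentSpace (𝓡 d) p [⋀^Fin n]→L[ℝ] ℝ))

/-- The coordinate expression of `α` in the preferred chart around `x₀`: the pullback of `α` under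
the inverse of the chart. It is meaningful on the (open) target of the chart. -/
def DiffForm.inChart {n : ℕ} (α : DiffForm d M n) (x₀ : M) (y : EuclideanSpace ℝ (Fin d)) :
    EuclideanSpace ℝ (Fin d) [⋀^Fin n]→L[ℝ] ℝ :=
  (α ((extChartAt (𝓡 d) x₀).symm y)).compContinuousLinearMap
    (mfderiv 𝓘(ℝ, EuclideanSpace ℝ (Fin d)) (𝓡 d) (extChartAt (𝓡 d) x₀).symm y)

/-- Smoothness of a form: all its coordinate expressions are smooth. -/
def DiffForm.IsSmooth {n : ℕ} (α : DiffForm d M n) : Prop :=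
  ∀ x₀ : M, ContDiffOn ℝ ∞ (α.inChart x₀) (extChartAt (𝓡 d) x₀).target

/-- The exterior derivative, computed at `p` in the preferred chart around `p`. -/
def DiffForm.extD {n : ℕ} (α : DiffForm d M n) : DiffForm d M (n + 1) := fun p =>
  (extDeriv (α.inChart p) (extChartAt (𝓡 d) p p)).compContinuousLinearMap
    (mfderiv (𝓡 d) 𝓘(ℝ, EuclideanSpace ℝ (Fin d)) (extChartAt (𝓡 d) p) p)

/-- The contraction `ι_V α = α(V, ·, …, ·)` of a form with a vector field. -/
def DiffForm.contract {n : ℕ} (V : ∀ p : M, TangentSpace (𝓡 d) p) (α : DiffForm d M (n + 1)) :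
    DiffForm d M n := fun p =>
  ContinuousAlternatingMap.curryLeft (E := EuclideanSpace ℝ (Fin d)) (α p) (V p)

theorem DiffForm.contract_apply {n : ℕ} (V : ∀ p : M, TangentSpace (𝓡 d) p)
    (α : DiffForm d M (n + 1)) (p : M) (v : Fin n → TangentSpace (𝓡 d) p) :
    α.contract V p v = α p (Fin.cons (V p) v : Fin (n + 1) → TangentSpace (𝓡 d) p) := rfl

theorem DiffForm.inChart_add {n : ℕ} (α η : DiffForm d M n) (x₀ : M) :
    (α + η).inChart x₀ = α.inChart x₀ + η.inChart x₀ := rfl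

theorem DiffForm.inChart_smul {n : ℕ} (c : ℝ) (α : DiffForm d M n) (x₀ : M) :
    (c • α).inChart x₀ = c • α.inChart x₀ := rfl

theorem DiffForm.inChart_zero {n : ℕ} (x₀ : M) :
    (0 : DiffForm d M n).inChart x₀ = 0 := rfl

theorem DiffForm.IsSmooth.add {n : ℕ} {α η : DiffForm d M n} (hα : α.IsSmooth)
    (hη : η.IsSmooth) : (α + η).IsSmooth := fun x₀ => (hα x₀).add (hη x₀)

theorem DiffForm.IsSmooth.smul {n : ℕ} (c : ℝ) {α : DiffForm d M n} (hα : α.IsSmooth) :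
    (c • α).IsSmooth := fun x₀ => (hα x₀).const_smul c

theorem DiffForm.isSmooth_zero {n : ℕ} : (0 : DiffForm d M n).IsSmooth :=
  fun x₀ => by rw [DiffForm.inChart_zero]; exact contDiffOn_const

theorem DiffForm.IsSmooth.differentiableAt {n : ℕ} {α : DiffForm d M n} (hα : α.IsSmooth)
    (p : M) : DifferentiableAt ℝ (α.inChart p) (extChartAt (𝓡 d) p p) :=
  ((hα p).contDiffAt (extChartAt_target_mem_nhds p)).differentiableAt (by simp)

theorem DiffForm.extD_add {n : ℕ} {α η : DiffForm d M n} (hα : α.IsSmooth)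
    (hη : η.IsSmooth) : (α + η).extD = α.extD + η.extD := by
  funext p
  simp only [DiffForm.extD, DiffForm.inChart_add,
    extDeriv_add (hα.differentiableAt p) (hη.differentiableAt p)]
  rfl

theorem DiffForm.extD_smul {n : ℕ} (c : ℝ) (α : DiffForm d M n) :
    (c • α).extD = c • α.extD := by
  funext p
  simp only [DiffForm.extD, DiffForm.inChart_smul, extDeriv_smul]
  rfl

theorem DiffForm.extD_zero {n : ℕ} : (0 : DiffForm d M n).extD = 0 := by
  simpa using DiffForm.extD_smul (0 : ℝ) (0 : DiffForm d M n)

variable (d M) in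
/-- The space of smooth closed `n`-forms. -/
def closedForms (n : ℕ) : Submodule ℝ (DiffForm d M n) where
  carrier := {α | α.IsSmooth ∧ α.extD = 0}
  zero_mem' := ⟨DiffForm.isSmooth_zero, DiffForm.extD_zero⟩
  add_mem' := fun ha hb =>
    ⟨ha.1.add hb.1, by rw [DiffForm.extD_add ha.1 hb.1, ha.2, hb.2, add_zero]⟩
  smul_mem' := fun c _ ha => ⟨ha.1.smul c, by rw [DiffForm.extD_smul, ha.2, smul_zero]⟩

variable (d M) in
/-- The space of exact `n`-forms: the exterior derivatives of smooth `(n - 1)`-forms. -/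
def exactForms : ∀ n : ℕ, Submodule ℝ (DiffForm d M n)
  | 0 => ⊥
  | n + 1 =>
    { carrier := {α | ∃ η : DiffForm d M n, η.IsSmooth ∧ η.extD = α}
      zero_mem' := ⟨0, DiffForm.isSmooth_zero, DiffForm.extD_zero⟩
      add_mem' := by
        rintro _ _ ⟨η, hη, rfl⟩ ⟨θ, hθ, rfl⟩
        exact ⟨η + θ, hη.add hθ, DiffForm.extD_add hη hθ⟩
      smul_mem' := by
        rintro c _ ⟨η, hη, rfl⟩
        exact ⟨c • η, hη.smul c, DiffForm.extD_smul c η⟩ }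

variable (d M) in
/-- De Rham cohomology: closed forms modulo exact forms. -/
abbrev DeRhamCohomology (n : ℕ) : Type _ :=
  closedForms d M n ⧸ (exactForms d M n).submoduleOf (closedForms d M n)

variable (d M) in
/-- The `n`-th Betti number, as a cardinal: the dimension of the `n`-th de Rham cohomology. -/
def bettiNumber (n : ℕ) : Cardinal := Module.rank ℝ (DeRhamCohomology d M n)

/-- `ψ` is a `4`-plectic form: smooth, closed and non-degenerate. -/
structure IsFourPlectic (ψ : DiffForm d M 4) : Prop where
  smooth : ψ.IsSmooth
  closed : ψ.extD = 0
  nondegenerate : ∀ (p : M) (v : TangentSpace (𝓡 d) p),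
    (∀ w : Fin 3 → TangentSpace (𝓡 d) p, ψ p (Fin.cons v w) = 0) → v = 0

/-- A vector field `V` is Hamiltonian if `ι_V ψ` is exact. -/
def IsHamiltonianField (ψ : DiffForm d M 4) (V : ∀ p : M, TangentSpace (𝓡 d) p) : Prop :=
  ψ.contract V ∈ exactForms d M 3

end Forms

/-! ### The group `Sp(1)^k` and its Lie algebra -/

instance quaternion_finrank_fact : Fact (Module.finrank ℝ ℍ[ℝ] = 3 + 1) :=
  ⟨Quaternion.finrank_eq_four⟩

/-- `Sp(1)`, the group of unit quaternions, with its manifold structure as the `3`-sphere. -/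
abbrev Sp1 : Type := Metric.sphere (0 : ℍ[ℝ]) 1

/-- `Sp(1)^k`, as a group and as a product manifold. -/
abbrev Sp1Pow (k : ℕ) : Type := Fin k → Sp1

/-- The model with corners of the product manifold `Sp(1)^k`. -/
abbrev Sp1Pow.model (k : ℕ) := ModelWithCorners.pi (fun _ : Fin k => 𝓡 3)

/-- The Lie algebra `sp(1)` of `Sp(1)`: the purely imaginary quaternions. -/
def sp1 : Submodule ℝ ℍ[ℝ] where
  carrier := {q | q.re = 0}
  zero_mem' := Quaternion.re_zero
  add_mem' := fun {a b} (ha : a.re = 0) (hb : b.re = 0) => by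
    simp [ha, hb]
  smul_mem' := fun c a (ha : a.re = 0) => by
    simp [ha]

/-- `sp(1)` as a type. -/
abbrev LieSp1 : Type := sp1

theorem LieSp1.re_eq_zero (X : LieSp1) : (X : ℍ[ℝ]).re = 0 := X.2

/-- The exponential map `sp(1) → Sp(1)`, given by the exponential series of quaternions. -/
def LieSp1.exp (X : LieSp1) : Sp1 :=
  ⟨NormedSpace.exp (X : ℍ[ℝ]), by
    rw [mem_sphere_zero_iff_norm, Quaternion.norm_exp, LieSp1.re_eq_zero X, NormedSpace.exp_zero,
      norm_one]⟩

/-- The exponential map `sp(1)^k → Sp(1)^k`. -/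
def sp1PowExp {k : ℕ} (X : Fin k → LieSp1) : Sp1Pow k := fun i => LieSp1.exp (X i)

/-! ### Generalized Hamiltonian actions and tri-moment maps -/

section Action

variable {d k : ℕ} {M : Type*} [TopologicalSpace M] [ChartedSpace (EuclideanSpace ℝ (Fin d)) M]
  [MulAction (Sp1Pow k) M]

/-- The fundamental vector field `p ↦ d/dt|₀ exp (t X) • p`. The curve passes through `p` at time
`0`, so its velocity at time `0` is a tangent vector at `p`. -/
def fundamentalField (X : Fin k → LieSp1) (p : M) : TangentSpace (𝓡 d) p :=
  mfderiv 𝓘(ℝ, ℝ) (𝓡 d) (fun t : ℝ => sp1PowExp (t • X) • p) 0 (1 : ℝ)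

variable (k) in
/-- The action of `Sp(1)^k` on `M` preserves `ψ`, and all its fundamental vector fields are
Hamiltonian. -/
structure IsGeneralizedHamiltonian (ψ : DiffForm d M 4) : Prop where
  preserves : ∀ (g : Sp1Pow k) (p : M),
    (ψ (g • p)).compContinuousLinearMap (mfderiv (𝓡 d) (𝓡 d) (fun q : M => g • q) p) = ψ p
  hamiltonian : ∀ X : Fin k → LieSp1, IsHamiltonianField ψ (fundamentalField X)

/-- The `k`-tuple `(U₁ ∧ V₁ ∧ W₁, …, U_k ∧ V_k ∧ W_k)` in `(Λ³ sp(1))^k`. Since `sp(1)` is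
three-dimensional, every element of `(Λ³ sp(1))^k` is of this form. -/
def triVector (U V W : Fin k → LieSp1) : Fin k → ⋀[ℝ]^3 LieSp1 :=
  fun i => exteriorPower.ιMulti ℝ 3 ![U i, V i, W i]

variable (k) in
/-- `σ : M → ((Λ³ sp(1))^k)^*` is a tri-moment map. Smoothness and differential of a map with
values in the finite-dimensional dual space are those of the evaluations `p ↦ σ p δ`, and an
element of `sp(1)` is placed in the `i`-th summand of `sp(1)^k` by `Pi.single i`. -/
structure IsTriMomentMap (ψ : DiffForm d M 4)
    (σ : M → Module.Dual ℝ (Fin k → ⋀[ℝ]^3 LieSp1)) : Prop where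
  smooth : ∀ δ : Fin k → ⋀[ℝ]^3 LieSp1, ContMDiff (𝓡 d) 𝓘(ℝ, ℝ) ∞ (fun p => σ p δ)
  invariant : ∀ (g : Sp1Pow k) (p : M), σ (g • p) = σ p
  differential : ∀ (U V W : Fin k → LieSp1) (p : M) (v : TangentSpace (𝓡 d) p),
    mfderiv (𝓡 d) 𝓘(ℝ, ℝ) (fun q => σ q (triVector U V W)) p v =
      ∑ i, ψ p ![fundamentalField (Pi.single i (U i)) p, fundamentalField (Pi.single i (V i)) p,
        fundamentalField (Pi.single i (W i)) p, v]

end Action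

end

noncomputable section

/-! ### The exponential and adjoint maps of `Sp(1)^k` -/

/-! Since `Λ³ sp(1)` is a line, a tri-moment map amounts to `k` real functions. For the `i`-th
factor, write `X₁, X₂, X₃` for the fundamental fields of the basis `sp1E₁, sp1E₂, sp1E₃` and put `βᵢ
= ψ(X₁, X₂, X₃, ·)`. Any other triple in that factor gives `βᵢ` times its triple product, because
alternating 3-forms on `sp(1)` are multiples of `tripleProduct`. So primitives `ηᵢ` of the `βᵢ`
suffice: `σ` pairs `ηᵢ` with the functional on the `i`-th copy of `Λ³ sp(1)` induced by
`tripleProduct`.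

Closedness of `βᵢ` is Cartan calculus. Expanding `dβᵢ` leaves terms in `dψ`, terms in the Lie
derivatives of `ψ` along the `Xⱼ`, and terms containing a bracket `[Xₐ, X_b]` next to the third
field. The first two kinds vanish since `ψ` is closed and invariant; the last vanish since the
bracket is a multiple of that third field (`extDeriv_curryLeft_three_eq_zero`). Then `b₁ = 0` yields
`ηᵢ`.

For invariance, `βᵢ` is itself invariant because `Ad` preserves the triple product. Hence `ηᵢ(g·) -
ηᵢ` is locally constant, so it is a constant `c` along a connected orbit, and `ηᵢ(gⁿ p) = ηᵢ(p) + n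
c`. Compactness of the orbit forces `c = 0` (`smul_eq_of_mfderiv_invariant`). -/

theorem contMDiff_pi_manifold {ι : Type*} [Fintype ι] {E H : ι → Type*}
    [∀ i, NormedAddCommGroup (E i)] [∀ i, NormedSpace ℝ (E i)] [∀ i, TopologicalSpace (H i)]
    {I : ∀ i, ModelWithCorners ℝ (E i) (H i)} {N : ι → Type*} [∀ i, TopologicalSpace (N i)]
    [∀ i, ChartedSpace (H i) (N i)] {E' H' : Type*} [NormedAddCommGroup E'] [NormedSpace ℝ E']
    [TopologicalSpace H'] {I' : ModelWithCorners ℝ E' H'} {M' : Type*} [TopologicalSpace M']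
    [ChartedSpace H' M'] {n : ℕ∞ω} {f : M' → ∀ i, N i}
    (hf : ∀ i, ContMDiff I' (I i) n (fun x => f x i)) :
    ContMDiff I' (ModelWithCorners.pi I) n f := by
  intro x
  rw [contMDiffAt_iff]
  refine ⟨continuousAt_pi.2 fun i => (hf i x).continuousAt, ?_⟩
  rw [contDiffWithinAt_pi]
  intro i
  exact (contMDiffAt_iff.1 (hf i x)).2

theorem contMDiff_lieSp1Exp : ContMDiff 𝓘(ℝ, LieSp1) (𝓡 3) ∞ LieSp1.exp := by
  have h : ContDiff ℝ ∞ (fun X : LieSp1 => NormedSpace.exp (X : ℍ[ℝ])) :=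
    (contDiff_iff_contDiffAt.2 fun q =>
      (NormedSpace.exp_analytic (𝕂 := ℝ) (𝔸 := ℍ[ℝ]) q).contDiffAt).comp sp1.subtypeL.contDiff
  exact h.contMDiff.codRestrict_sphere _

theorem contMDiff_sp1PowExp (k : ℕ) :
    ContMDiff 𝓘(ℝ, Fin k → LieSp1) (Sp1Pow.model k) ∞ (sp1PowExp (k := k)) :=
  contMDiff_pi_manifold fun i => contMDiff_lieSp1Exp.comp
    (ContinuousLinearMap.proj (R := ℝ) (φ := fun _ : Fin k => LieSp1) i).contDiff.contMDiff

theorem sp1PowExp_zero {k : ℕ} : sp1PowExp (0 : Fin k → LieSp1) = 1 := by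
  funext i
  exact Subtype.ext (by simp [sp1PowExp, LieSp1.exp])

theorem re_conj_eq (g q : ℍ[ℝ]) (hg : g ≠ 0) : (g⁻¹ * q * g).re = q.re := by
  have h : ∀ a b : ℍ[ℝ], (a * b).re = (b * a).re := fun a b => by
    simp only [Quaternion.re_mul]; ring
  rw [h, ← mul_assoc, mul_inv_cancel₀ hg, one_mul]

/-- The linear map `X ↦ g⁻¹ X g` of `sp(1)`, i.e. `Ad (g⁻¹)`. -/
def sp1Conj (g : Sp1) : LieSp1 →ₗ[ℝ] LieSp1 where
  toFun X := ⟨(g : ℍ[ℝ])⁻¹ * X * g, by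
    change QuaternionAlgebra.re _ = 0
    rw [re_conj_eq _ _ (ne_zero_of_mem_unit_sphere g), LieSp1.re_eq_zero]⟩
  map_add' X Y := Subtype.ext (by simp [mul_add, add_mul])
  map_smul' c X := Subtype.ext (by simp)

theorem coe_sp1Conj (g : Sp1) (X : LieSp1) :
    (sp1Conj g X : ℍ[ℝ]) = (g : ℍ[ℝ])⁻¹ * X * g := rfl

/-- The linear map `Ad (g⁻¹)` of `sp(1)^k`. -/
def sp1PowConj {k : ℕ} (g : Sp1Pow k) (X : Fin k → LieSp1) : Fin k → LieSp1 :=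
  fun i => sp1Conj (g i) (X i)

theorem sp1PowConj_single {k : ℕ} (g : Sp1Pow k) (i : Fin k) (X : LieSp1) :
    sp1PowConj g (Pi.single i X) = Pi.single i (sp1Conj (g i) X) := by
  funext j
  by_cases h : j = i
  · subst h; simp [sp1PowConj]
  · simp [sp1PowConj, h]

/-- Conjugation commutes with the exponential series. This is what makes fundamental fields
equivariant. -/
theorem sp1PowExp_mul {k : ℕ} (g : Sp1Pow k) (X : Fin k → LieSp1) :
    sp1PowExp X * g = g * sp1PowExp (sp1PowConj g X) := by
  funext i
  apply Subtype.ext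
  have hg := ne_zero_of_mem_unit_sphere (g i)
  change NormedSpace.exp (X i : ℍ[ℝ]) * (g i : ℍ[ℝ]) =
    (g i : ℍ[ℝ]) * NormedSpace.exp ((g i : ℍ[ℝ])⁻¹ * X i * g i)
  let _ : NormedAlgebra ℚ ℍ[ℝ] := NormedAlgebra.restrictScalars ℚ ℝ ℍ[ℝ]
  rw [NormedSpace.exp_conj' _ _ hg, ← mul_assoc, ← mul_assoc, mul_inv_cancel₀ hg, one_mul]

/-- The commutator `Y X - X Y` in `sp(1)`. -/
def sp1Comm (Y X : LieSp1) : LieSp1 :=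
  ⟨(Y : ℍ[ℝ]) * X - X * Y, by
    change QuaternionAlgebra.re _ = 0
    simp only [Quaternion.re_sub, Quaternion.re_mul]; ring⟩

/-- Product rule for `exp(-tX) Y exp(tX)`; it fixes the order `Y X - X Y` in `sp1Comm`. -/
theorem hasDerivAt_sp1Conj_exp (X Y : LieSp1) :
    HasDerivAt (fun t : ℝ => sp1Conj (LieSp1.exp (t • X)) Y) (sp1Comm Y X) 0 := by
  have hpos : HasDerivAt (fun t : ℝ => NormedSpace.exp (t • (X : ℍ[ℝ]))) (X : ℍ[ℝ]) 0 := by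
    simpa using hasDerivAt_exp_smul_const (𝕂 := ℝ) (X : ℍ[ℝ]) (0 : ℝ)
  have hneg : HasDerivAt (fun t : ℝ => NormedSpace.exp (t • (-X : ℍ[ℝ]))) (-X : ℍ[ℝ]) 0 := by
    simpa using hasDerivAt_exp_smul_const (𝕂 := ℝ) (-X : ℍ[ℝ]) (0 : ℝ)
  have h := (hneg.mul_const (Y : ℍ[ℝ])).mul hpos
  have heq : ∀ t : ℝ, ((sp1Conj (LieSp1.exp (t • X)) Y : LieSp1) : ℍ[ℝ]) =
      NormedSpace.exp (t • (-X : ℍ[ℝ])) * Y * NormedSpace.exp (t • (X : ℍ[ℝ])) := by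
    intro t
    let _ : NormedAlgebra ℚ ℍ[ℝ] := NormedAlgebra.restrictScalars ℚ ℝ ℍ[ℝ]
    rw [coe_sp1Conj, smul_neg, NormedSpace.exp_neg]
    rfl
  have h2 : HasDerivAt (fun t : ℝ => ((sp1Conj (LieSp1.exp (t • X)) Y : LieSp1) : ℍ[ℝ]))
      (sp1Comm Y X : ℍ[ℝ]) 0 := by
    simp only [heq]
    refine h.congr_deriv ?_
    simp [sp1Comm]
    abel
  -- The derivative is known in `ℍ`; it descends to the subspace because slopes are computed there
  -- and the topology is induced.
  rw [hasDerivAt_iff_tendsto_slope] at h2 ⊢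
  rw [tendsto_subtype_rng]
  refine h2.congr fun t => ?_
  simp [slope_def_module]

theorem hasDerivAt_sp1PowConj_exp {k : ℕ} (X Y : Fin k → LieSp1) :
    HasDerivAt (fun t : ℝ => sp1PowConj (sp1PowExp (t • X)) Y) (fun i => sp1Comm (Y i) (X i)) 0 :=
  hasDerivAt_pi.2 fun i => hasDerivAt_sp1Conj_exp (X i) (Y i)

/-! ### The triple product on `sp(1)` -/

/-- The basis vector `i` of `sp(1)`. -/
def sp1E₁ : LieSp1 := ⟨(⟨0, 1, 0, 0⟩ : ℍ[ℝ]), rfl⟩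

/-- The basis vector `j` of `sp(1)`. -/
def sp1E₂ : LieSp1 := ⟨(⟨0, 0, 1, 0⟩ : ℍ[ℝ]), rfl⟩

/-- The basis vector `k` of `sp(1)`. -/
def sp1E₃ : LieSp1 := ⟨(⟨0, 0, 0, 1⟩ : ℍ[ℝ]), rfl⟩

@[simp] theorem sp1E₁_imI : (sp1E₁ : ℍ[ℝ]).imI = 1 := rfl
@[simp] theorem sp1E₁_imJ : (sp1E₁ : ℍ[ℝ]).imJ = 0 := rfl
@[simp] theorem sp1E₁_imK : (sp1E₁ : ℍ[ℝ]).imK = 0 := rfl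
@[simp] theorem sp1E₁_re : (sp1E₁ : ℍ[ℝ]).re = 0 := rfl

@[simp] theorem sp1E₂_imI : (sp1E₂ : ℍ[ℝ]).imI = 0 := rfl
@[simp] theorem sp1E₂_imJ : (sp1E₂ : ℍ[ℝ]).imJ = 1 := rfl
@[simp] theorem sp1E₂_imK : (sp1E₂ : ℍ[ℝ]).imK = 0 := rfl
@[simp] theorem sp1E₂_re : (sp1E₂ : ℍ[ℝ]).re = 0 := rfl

@[simp] theorem sp1E₃_imI : (sp1E₃ : ℍ[ℝ]).imI = 0 := rfl
@[simp] theorem sp1E₃_imJ : (sp1E₃ : ℍ[ℝ]).imJ = 0 := rfl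
@[simp] theorem sp1E₃_imK : (sp1E₃ : ℍ[ℝ]).imK = 1 := rfl
@[simp] theorem sp1E₃_re : (sp1E₃ : ℍ[ℝ]).re = 0 := rfl

theorem sp1_ext {X Y : LieSp1} (hI : (X : ℍ[ℝ]).imI = (Y : ℍ[ℝ]).imI)
    (hJ : (X : ℍ[ℝ]).imJ = (Y : ℍ[ℝ]).imJ) (hK : (X : ℍ[ℝ]).imK = (Y : ℍ[ℝ]).imK) : X = Y :=
  Subtype.ext (QuaternionAlgebra.ext (by rw [LieSp1.re_eq_zero, LieSp1.re_eq_zero]) hI hJ hK)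

/-- With the next two: the bracket of two basis vectors is a multiple of the third, the one fact
about `sp(1)` used for closedness. -/
theorem sp1Comm_E₂_E₁ : sp1Comm sp1E₂ sp1E₁ = (-2 : ℝ) • sp1E₃ := by
  apply sp1_ext <;> (simp [sp1Comm]; try norm_num)

theorem sp1Comm_E₃_E₁ : sp1Comm sp1E₃ sp1E₁ = (2 : ℝ) • sp1E₂ := by
  apply sp1_ext <;> (simp [sp1Comm]; try norm_num)

theorem sp1Comm_E₃_E₂ : sp1Comm sp1E₃ sp1E₂ = (-2 : ℝ) • sp1E₁ := by
  apply sp1_ext <;> (simp [sp1Comm]; try norm_num)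

theorem sp1_eq_sum (X : LieSp1) : X = (X : ℍ[ℝ]).imI • sp1E₁ + (X : ℍ[ℝ]).imJ • sp1E₂ +
    (X : ℍ[ℝ]).imK • sp1E₃ := by
  apply sp1_ext <;> simp

/-- The triple product `(U, V, W) ↦ -Re (U V W)`, an alternating form on `sp(1)`. -/
def tripleProduct : LieSp1 [⋀^Fin 3]→ₗ[ℝ] ℝ where
  toFun u := -((u 0 : ℍ[ℝ]) * u 1 * u 2).re
  map_update_add' {inst} u i x y := by
    obtain rfl : inst = instDecidableEqFin 3 := Subsingleton.elim _ _
    obtain rfl | rfl | rfl : i = 0 ∨ i = 1 ∨ i = 2 := by fin_cases i <;> simp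
    all_goals simp [mul_add, add_mul]
    all_goals ring
  map_update_smul' {inst} u i c x := by
    obtain rfl : inst = instDecidableEqFin 3 := Subsingleton.elim _ _
    obtain rfl | rfl | rfl : i = 0 ∨ i = 1 ∨ i = 2 := by fin_cases i <;> simp
    all_goals simp
    all_goals ring
  map_eq_zero_of_eq' u i j h hij := by
    have h0 := LieSp1.re_eq_zero (u 0)
    have h1 := LieSp1.re_eq_zero (u 1)
    have h2 := LieSp1.re_eq_zero (u 2)
    have h3 : u 0 = u 1 ∨ u 0 = u 2 ∨ u 1 = u 2 := by
      obtain rfl | rfl | rfl : i = 0 ∨ i = 1 ∨ i = 2 := by fin_cases i <;> simp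
      all_goals obtain rfl | rfl | rfl : j = 0 ∨ j = 1 ∨ j = 2 := by fin_cases j <;> simp
      all_goals first | exact absurd rfl hij | simp [h]
    rcases h3 with h3 | h3 | h3
    all_goals simp only [h3, Quaternion.re_mul, Quaternion.imI_mul, Quaternion.imJ_mul,
      Quaternion.imK_mul, h0, h1, h2]
    all_goals ring

theorem tripleProduct_apply (U V W : LieSp1) :
    tripleProduct ![U, V, W] = -((U : ℍ[ℝ]) * V * W).re := rfl

theorem tripleProduct_basis : tripleProduct ![sp1E₁, sp1E₂, sp1E₃] = 1 := by
  simp [tripleProduct_apply]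

/-- The inner factors `g g⁻¹` cancel and the real part is conjugation invariant; this plays the role
of `det Ad = 1`. -/
theorem tripleProduct_conj (g : Sp1) (U V W : LieSp1) :
    tripleProduct ![sp1Conj g U, sp1Conj g V, sp1Conj g W] = tripleProduct ![U, V, W] := by
  have hg := ne_zero_of_mem_unit_sphere g
  rw [tripleProduct_apply, tripleProduct_apply, ← re_conj_eq _ ((U : ℍ[ℝ]) * V * W) hg]
  simp only [coe_sp1Conj, mul_assoc, mul_inv_cancel_left₀ hg]

theorem sp1_span : Submodule.span ℝ (Set.range ![sp1E₁, sp1E₂, sp1E₃]) = ⊤ := by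
  rw [Submodule.eq_top_iff']
  intro X
  rw [sp1_eq_sum X]
  refine add_mem (add_mem ?_ ?_) ?_ <;> refine Submodule.smul_mem _ _ (Submodule.subset_span ?_)
  exacts [⟨0, rfl⟩, ⟨1, rfl⟩, ⟨2, rfl⟩]

/-- Both `f` and `tripleProduct` are multiples of the determinant of the basis, and `tripleProduct`
equals `1` on it. -/
theorem alternatingMap_sp1_eq (f : LieSp1 [⋀^Fin 3]→ₗ[ℝ] ℝ) (u : Fin 3 → LieSp1) :
    f u = tripleProduct u * f ![sp1E₁, sp1E₂, sp1E₃] := by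
  have hli : LinearIndependent ℝ ![sp1E₁, sp1E₂, sp1E₃] := by
    rw [Fintype.linearIndependent_iff]
    intro c hc
    have h : (c 0 • sp1E₁ + c 1 • sp1E₂ + c 2 • sp1E₃ : LieSp1) = 0 := by
      simpa [Fin.sum_univ_three] using hc
    have hI := congrArg (fun X : LieSp1 => (X : ℍ[ℝ]).imI) h
    have hJ := congrArg (fun X : LieSp1 => (X : ℍ[ℝ]).imJ) h
    have hK := congrArg (fun X : LieSp1 => (X : ℍ[ℝ]).imK) h
    simp at hI hJ hK
    intro i
    fin_cases i <;> assumption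
  let b := Module.Basis.mk hli sp1_span.ge
  have hb : (b : Fin 3 → LieSp1) = ![sp1E₁, sp1E₂, sp1E₃] := Module.Basis.coe_mk _ _
  have hf := f.eq_smul_basis_det b
  have ht := tripleProduct.eq_smul_basis_det b
  rw [hb, tripleProduct_basis, one_smul] at ht
  rw [hb, ← ht] at hf
  conv_lhs => rw [hf]
  simp [mul_comm]

/-! ### Topology of `Sp(1)^k` -/

instance : PathConnectedSpace Sp1 := by
  rw [← isPathConnected_iff_pathConnectedSpace]
  refine isPathConnected_sphere ?_ 0 zero_le_one
  rw [Quaternion.rank_eq_four]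
  norm_num

/-! ### Coordinate expressions of the action -/

section Coordinates

variable {d k : ℕ} {M : Type*} [TopologicalSpace M] [ChartedSpace (EuclideanSpace ℝ (Fin d)) M]

theorem mdifferentiableAt_extChartAt_symm_of_mem [IsManifold (𝓡 d) ∞ M] {x₀ : M}
    {y : EuclideanSpace ℝ (Fin d)} (hy : y ∈ (extChartAt (𝓡 d) x₀).target) :
    MDifferentiableAt 𝓘(ℝ, EuclideanSpace ℝ (Fin d)) (𝓡 d) (extChartAt (𝓡 d) x₀).symm y :=
  ((contMDiffOn_extChartAt_symm (n := ∞) x₀).contMDiffAt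
    ((isOpen_extChartAt_target x₀).mem_nhds hy)).mdifferentiableAt (by simp)

theorem mfderiv_extChartAt_symm_injective [IsManifold (𝓡 d) ∞ M] {x₀ : M}
    {y : EuclideanSpace ℝ (Fin d)} (hy : y ∈ (extChartAt (𝓡 d) x₀).target) :
    Function.Injective (mfderiv 𝓘(ℝ, EuclideanSpace ℝ (Fin d)) (𝓡 d)
      (extChartAt (𝓡 d) x₀).symm y) := by
  have : IsManifold (𝓡 d) 1 M := IsManifold.of_le (n := ∞) (by simp)
  have h := isInvertible_mfderivWithin_extChartAt_symm hy
  rw [ModelWithCorners.range_eq_univ, mfderivWithin_univ] at h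
  exact h.injective

theorem mfderiv_extChartAt_surjective [IsManifold (𝓡 d) ∞ M] (p : M) :
    Function.Surjective (mfderiv (𝓡 d) 𝓘(ℝ, EuclideanSpace ℝ (Fin d))
      (extChartAt (𝓡 d) p) p) := by
  have : IsManifold (𝓡 d) 1 M := IsManifold.of_le (n := ∞) (by simp)
  exact (isInvertible_mfderiv_extChartAt (mem_extChartAt_source p)).surjective

theorem DiffForm.inChart_contract {n : ℕ} (α : DiffForm d M (n + 1))
    (V : ∀ p : M, TangentSpace (𝓡 d) p) {x₀ : M} {y w : EuclideanSpace ℝ (Fin d)}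
    (hw : V ((extChartAt (𝓡 d) x₀).symm y) =
      mfderiv 𝓘(ℝ, EuclideanSpace ℝ (Fin d)) (𝓡 d) (extChartAt (𝓡 d) x₀).symm y w) :
    (α.contract V).inChart x₀ y = (α.inChart x₀ y).curryLeft w := by
  rw [DiffForm.inChart, DiffForm.contract, hw]
  exact (ContinuousAlternatingMap.curryLeft_compContinuousLinearMap
    (E := EuclideanSpace ℝ (Fin d)) (F := EuclideanSpace ℝ (Fin d)) _ _ _).symm

theorem DiffForm.IsSmooth.contract {n : ℕ} {α : DiffForm d M (n + 1)} (hα : α.IsSmooth)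
    {V : ∀ p : M, TangentSpace (𝓡 d) p}
    {W : M → EuclideanSpace ℝ (Fin d) → EuclideanSpace ℝ (Fin d)}
    (hW : ∀ x₀, ContDiffOn ℝ ∞ (W x₀) (extChartAt (𝓡 d) x₀).target)
    (hVW : ∀ x₀, ∀ y ∈ (extChartAt (𝓡 d) x₀).target, V ((extChartAt (𝓡 d) x₀).symm y) =
      mfderiv 𝓘(ℝ, EuclideanSpace ℝ (Fin d)) (𝓡 d) (extChartAt (𝓡 d) x₀).symm y (W x₀ y)) :
    (α.contract V).IsSmooth := fun x₀ => by
  have h := ((ContinuousAlternatingMap.curryLeftLI (𝕜 := ℝ)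
    (E := EuclideanSpace ℝ (Fin d)) (F := ℝ)
    (n := n)).toContinuousLinearMap.contDiff.comp_contDiffOn (hα x₀)).clm_apply (hW x₀)
  exact h.congr fun y hy => α.inChart_contract V (hVW x₀ y hy)

theorem hasDerivAt_smul_prodMk (X : Fin k → LieSp1) (y : EuclideanSpace ℝ (Fin d)) :
    HasDerivAt (fun t : ℝ => (t • X, y)) (X, 0) 0 := by
  simpa using ((hasDerivAt_id (0 : ℝ)).smul_const X).prodMk (hasDerivAt_const (0 : ℝ) y)

variable [MulAction (Sp1Pow k) M]

/-- The map `(X, q) ↦ exp X • q` in the preferred chart around `x₀`. -/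
def actionInChart (x₀ : M) (z : (Fin k → LieSp1) × EuclideanSpace ℝ (Fin d)) :
    EuclideanSpace ℝ (Fin d) :=
  extChartAt (𝓡 d) x₀ (sp1PowExp z.1 • (extChartAt (𝓡 d) x₀).symm z.2)

/-- The fundamental vector field of `X` in the preferred chart around `x₀`. -/
def fieldInChart (x₀ : M) (X : Fin k → LieSp1) (y : EuclideanSpace ℝ (Fin d)) :
    EuclideanSpace ℝ (Fin d) :=
  fderiv ℝ (actionInChart x₀) ((0 : Fin k → LieSp1), y) (X, 0)

theorem actionInChart_zero {x₀ : M} {y : EuclideanSpace ℝ (Fin d)}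
    (hy : y ∈ (extChartAt (𝓡 d) x₀).target) :
    actionInChart x₀ ((0 : Fin k → LieSp1), y) = y := by
  rw [actionInChart, sp1PowExp_zero, one_smul, (extChartAt (𝓡 d) x₀).right_inv hy]

variable [IsManifold (𝓡 d) ∞ M] [ContMDiffSMul (Sp1Pow.model k) (𝓡 d) ∞ (Sp1Pow k) M]

theorem contDiffAt_actionInChart {x₀ : M} {X : Fin k → LieSp1} {y : EuclideanSpace ℝ (Fin d)}
    (hy : y ∈ (extChartAt (𝓡 d) x₀).target)
    (hX : sp1PowExp X • (extChartAt (𝓡 d) x₀).symm y ∈ (extChartAt (𝓡 d) x₀).source) :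
    ContDiffAt ℝ ∞ (actionInChart x₀) (X, y) := by
  rw [← contMDiffAt_iff_contDiffAt]
  have h1 : ContMDiffAt 𝓘(ℝ, (Fin k → LieSp1) × EuclideanSpace ℝ (Fin d)) (Sp1Pow.model k) ∞
      (fun z : (Fin k → LieSp1) × EuclideanSpace ℝ (Fin d) => sp1PowExp z.1) (X, y) :=
    ((contMDiff_sp1PowExp k).comp contDiff_fst.contMDiff).contMDiffAt
  have h2 : ContMDiffAt 𝓘(ℝ, (Fin k → LieSp1) × EuclideanSpace ℝ (Fin d)) (𝓡 d) ∞
      (fun z : (Fin k → LieSp1) × EuclideanSpace ℝ (Fin d) =>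
        (extChartAt (𝓡 d) x₀).symm z.2) (X, y) :=
    ContMDiffAt.comp (g := (extChartAt (𝓡 d) x₀).symm) (X, y)
      ((contMDiffOn_extChartAt_symm (n := ∞) x₀).contMDiffAt
        ((isOpen_extChartAt_target x₀).mem_nhds hy)) contDiff_snd.contMDiff.contMDiffAt
  have h3 := h1.smul h2
  exact ContMDiffAt.comp (g := extChartAt (𝓡 d) x₀) (X, y)
    (contMDiffAt_extChartAt' (by simpa using hX)) h3

theorem contDiffAt_actionInChart_zero {x₀ : M} {y : EuclideanSpace ℝ (Fin d)}
    (hy : y ∈ (extChartAt (𝓡 d) x₀).target) :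
    ContDiffAt ℝ ∞ (actionInChart x₀) ((0 : Fin k → LieSp1), y) :=
  contDiffAt_actionInChart hy
    (by simpa [sp1PowExp_zero] using (extChartAt (𝓡 d) x₀).map_target hy)

theorem contDiffOn_fieldInChart (x₀ : M) (X : Fin k → LieSp1) :
    ContDiffOn ℝ ∞ (fieldInChart x₀ X) (extChartAt (𝓡 d) x₀).target := fun y hy => by
  have h := (contDiffAt_actionInChart_zero (k := k) hy).fderiv_right (m := ∞) (by simp)
  have h2 : ContDiffAt ℝ ∞ (fun y : EuclideanSpace ℝ (Fin d) =>
      fderiv ℝ (actionInChart x₀) ((0 : Fin k → LieSp1), y)) y :=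
    h.comp y (contDiffAt_const.prodMk contDiffAt_id)
  exact (h2.clm_apply contDiffAt_const).contDiffWithinAt

theorem eventually_exp_smul_mem_source (X : Fin k → LieSp1) {x₀ p : M}
    (hp : p ∈ (extChartAt (𝓡 d) x₀).source) :
    ∀ᶠ t : ℝ in 𝓝 0, sp1PowExp (t • X) • p ∈ (extChartAt (𝓡 d) x₀).source := by
  have := ContMDiffSMul.continuousSMul (I := Sp1Pow.model k) (I' := 𝓡 d) (G := Sp1Pow k) (M := M) ∞
  have h := (contMDiff_sp1PowExp k).continuous
  have hc : Continuous fun t : ℝ => sp1PowExp (t • X) • p := by fun_prop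
  refine hc.continuousAt.eventually_mem ?_
  exact (isOpen_extChartAt_source x₀).mem_nhds (by simpa [sp1PowExp_zero] using hp)

theorem hasDerivAt_actionInChart (X : Fin k → LieSp1) {x₀ : M} {y : EuclideanSpace ℝ (Fin d)}
    (hy : y ∈ (extChartAt (𝓡 d) x₀).target) :
    HasDerivAt (fun t : ℝ => actionInChart x₀ (t • X, y)) (fieldInChart x₀ X y) 0 := by
  have hF := ((contDiffAt_actionInChart_zero (k := k) hy).differentiableAt (by simp)).hasFDerivAt
  rw [← zero_smul ℝ X] at hF
  refine (hF.comp_hasDerivAt (0 : ℝ) (hasDerivAt_smul_prodMk X y)).congr_deriv ?_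
  rw [zero_smul]
  rfl

/-- For small `t` the orbit stays in the chart domain, so the chain rule applies to its coordinate
curve. It reduces the calculus of fundamental fields to `fderiv` in a vector space. -/
theorem fundamentalField_extChartAt_symm (X : Fin k → LieSp1) {x₀ : M}
    {y : EuclideanSpace ℝ (Fin d)} (hy : y ∈ (extChartAt (𝓡 d) x₀).target) :
    fundamentalField X ((extChartAt (𝓡 d) x₀).symm y) =
      mfderiv 𝓘(ℝ, EuclideanSpace ℝ (Fin d)) (𝓡 d) (extChartAt (𝓡 d) x₀).symm y
        (fieldInChart x₀ X y) := by
  have hp := (extChartAt (𝓡 d) x₀).map_target hy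
  have heq : (fun t : ℝ => sp1PowExp (t • X) • (extChartAt (𝓡 d) x₀).symm y) =ᶠ[𝓝 0]
      (extChartAt (𝓡 d) x₀).symm ∘ fun t : ℝ => actionInChart x₀ (t • X, y) := by
    filter_upwards [eventually_exp_smul_mem_source X hp] with t ht
    exact ((extChartAt (𝓡 d) x₀).left_inv ht).symm
  have hc := hasDerivAt_actionInChart X hy
  have h0 : actionInChart x₀ ((0 : ℝ) • X, y) = y := by rw [zero_smul, actionInChart_zero hy]
  have hs : HasMFDerivAt 𝓘(ℝ, EuclideanSpace ℝ (Fin d)) (𝓡 d) (extChartAt (𝓡 d) x₀).symm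
      (actionInChart x₀ ((0 : ℝ) • X, y)) (mfderiv 𝓘(ℝ, EuclideanSpace ℝ (Fin d)) (𝓡 d)
        (extChartAt (𝓡 d) x₀).symm (actionInChart x₀ ((0 : ℝ) • X, y))) :=
    (mdifferentiableAt_extChartAt_symm_of_mem (by rwa [h0])).hasMFDerivAt
  have h := (hs.comp (0 : ℝ) hc.hasFDerivAt.hasMFDerivAt).congr_of_eventuallyEq heq
  rw [fundamentalField, h.mfderiv]
  -- The base points agree only propositionally, so the derivatives are compared in the fixed model
  -- space.
  have key : ∀ z, z = y → (mfderiv 𝓘(ℝ, EuclideanSpace ℝ (Fin d)) (𝓡 d)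
      (extChartAt (𝓡 d) x₀).symm z : EuclideanSpace ℝ (Fin d) →L[ℝ] EuclideanSpace ℝ (Fin d))
        ((1 : ℝ) • fieldInChart x₀ X y) = (mfderiv 𝓘(ℝ, EuclideanSpace ℝ (Fin d)) (𝓡 d)
      (extChartAt (𝓡 d) x₀).symm y : EuclideanSpace ℝ (Fin d) →L[ℝ] EuclideanSpace ℝ (Fin d))
        (fieldInChart x₀ X y) := by
    rintro z rfl
    rw [one_smul]
  exact key _ h0

theorem DiffForm.IsSmooth.contract_fundamentalField {n : ℕ} {α : DiffForm d M (n + 1)}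
    (hα : α.IsSmooth) (X : Fin k → LieSp1) : (α.contract (fundamentalField X)).IsSmooth :=
  hα.contract (W := fun x₀ => fieldInChart x₀ X) (fun x₀ => contDiffOn_fieldInChart x₀ X)
    fun _ _ hy => fundamentalField_extChartAt_symm X hy

theorem DiffForm.inChart_contract_fundamentalField {n : ℕ} (α : DiffForm d M (n + 1))
    (X : Fin k → LieSp1) {x₀ : M} {y : EuclideanSpace ℝ (Fin d)}
    (hy : y ∈ (extChartAt (𝓡 d) x₀).target) :
    (α.contract (fundamentalField X)).inChart x₀ y =
      (α.inChart x₀ y).curryLeft (fieldInChart x₀ X y) :=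
  α.inChart_contract _ (fundamentalField_extChartAt_symm X hy)

theorem exists_fundamentalField_linear (p : M) :
    ∃ L : (Fin k → LieSp1) →ₗ[ℝ] EuclideanSpace ℝ (Fin d),
      ∀ X, fundamentalField (d := d) X p = L X := by
  have h := fun X : Fin k → LieSp1 =>
    fundamentalField_extChartAt_symm X (mem_extChartAt_target (I := 𝓡 d) p)
  rw [extChartAt_to_inv] at h
  let A : EuclideanSpace ℝ (Fin d) →L[ℝ] EuclideanSpace ℝ (Fin d) :=
    mfderiv 𝓘(ℝ, EuclideanSpace ℝ (Fin d)) (𝓡 d) (extChartAt (𝓡 d) p).symm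
      (extChartAt (𝓡 d) p p)
  let B : (Fin k → LieSp1) →L[ℝ] EuclideanSpace ℝ (Fin d) :=
    (fderiv ℝ (actionInChart p) ((0 : Fin k → LieSp1), extChartAt (𝓡 d) p p)).comp
      (ContinuousLinearMap.inl ℝ _ _)
  exact ⟨(A.comp B).toLinearMap, fun X => h X⟩

/-- Differentiate `exp(tX) g p = g exp(t Ad(g⁻¹)X) p` at `t = 0`. -/
theorem fundamentalField_smul (g : Sp1Pow k) (X : Fin k → LieSp1) (p : M) :
    fundamentalField (d := d) X (g • p) = mfderiv (𝓡 d) (𝓡 d) (fun q : M => g • q) p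
      (fundamentalField (sp1PowConj g X) p) := by
  have hconj : ∀ t : ℝ, sp1PowExp (t • X) • g • p =
      g • sp1PowExp (t • sp1PowConj g X) • p := fun t => by
    have : sp1PowConj g (t • X) = t • sp1PowConj g X := by
      funext i; exact (sp1Conj (g i)).map_smul t (X i)
    rw [← mul_smul (sp1PowExp (t • X)) g p, sp1PowExp_mul, this,
      mul_smul g (sp1PowExp (t • sp1PowConj g X)) p]
  have hc : MDifferentiableAt 𝓘(ℝ, ℝ) (𝓡 d)
      (fun t : ℝ => sp1PowExp (t • sp1PowConj g X) • p) 0 := by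
    have h1 : ContMDiff 𝓘(ℝ, ℝ) (Sp1Pow.model k) ∞
        (fun t : ℝ => sp1PowExp (t • sp1PowConj g X)) :=
      (contMDiff_sp1PowExp k).comp (contDiff_id.smul contDiff_const).contMDiff
    exact ((h1.smul contMDiff_const) 0).mdifferentiableAt (by simp)
  have hg : MDifferentiable (𝓡 d) (𝓡 d) (fun q : M => g • q) :=
    (ContMDiffSMul.contMDiff_const_smul (I := Sp1Pow.model k) (n := ∞) g).mdifferentiable (by simp)
  have h := (hg _).hasMFDerivAt.comp (0 : ℝ) hc.hasMFDerivAt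
  have h' := (h.congr_of_eventuallyEq (Filter.Eventually.of_forall hconj)).mfderiv
  rw [fundamentalField, h']
  have key : ∀ (q : M) (v : EuclideanSpace ℝ (Fin d)), q = p →
      (mfderiv (𝓡 d) (𝓡 d) (fun q : M => g • q) q :
        EuclideanSpace ℝ (Fin d) →L[ℝ] EuclideanSpace ℝ (Fin d)) v =
      (mfderiv (𝓡 d) (𝓡 d) (fun q : M => g • q) p :
        EuclideanSpace ℝ (Fin d) →L[ℝ] EuclideanSpace ℝ (Fin d)) v := by
    rintro q v rfl; rfl
  exact key _ _ (by rw [zero_smul, sp1PowExp_zero, one_smul])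

/-- Two factorisations of the same local map, differentiated: the `y`-derivative of `actionInChart`
represents the differential of `exp X`. -/
theorem mfderiv_symm_comp_fderiv_actionInChart {x₀ : M} {X : Fin k → LieSp1}
    {y : EuclideanSpace ℝ (Fin d)} (hy : y ∈ (extChartAt (𝓡 d) x₀).target)
    (hX : sp1PowExp X • (extChartAt (𝓡 d) x₀).symm y ∈ (extChartAt (𝓡 d) x₀).source)
    (a : EuclideanSpace ℝ (Fin d)) :
    mfderiv 𝓘(ℝ, EuclideanSpace ℝ (Fin d)) (𝓡 d) (extChartAt (𝓡 d) x₀).symm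
        (actionInChart x₀ (X, y)) (fderiv ℝ (actionInChart x₀) (X, y) (0, a)) =
      mfderiv (𝓡 d) (𝓡 d) (fun q : M => sp1PowExp X • q) ((extChartAt (𝓡 d) x₀).symm y)
        (mfderiv 𝓘(ℝ, EuclideanSpace ℝ (Fin d)) (𝓡 d) (extChartAt (𝓡 d) x₀).symm y a) := by
  have hg : MDifferentiable (𝓡 d) (𝓡 d) (fun q : M => sp1PowExp X • q) :=
    (ContMDiffSMul.contMDiff_const_smul (I := Sp1Pow.model k) (n := ∞) _).mdifferentiable (by simp)
  have h1 := (hg ((extChartAt (𝓡 d) x₀).symm y)).hasMFDerivAt.comp y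
    (mdifferentiableAt_extChartAt_symm_of_mem hy).hasMFDerivAt
  have hF : HasFDerivAt (fun y => actionInChart x₀ (X, y))
      ((fderiv ℝ (actionInChart x₀) (X, y)).comp (ContinuousLinearMap.inr ℝ _ _)) y :=
    ((contDiffAt_actionInChart hy hX).differentiableAt (by simp)).hasFDerivAt.comp y
      (hasFDerivAt_prodMk_right X y)
  have ht : actionInChart x₀ (X, y) ∈ (extChartAt (𝓡 d) x₀).target :=
    (extChartAt (𝓡 d) x₀).map_source hX
  have h2 := HasMFDerivAt.comp (f := fun y => actionInChart x₀ (X, y)) y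
    (mdifferentiableAt_extChartAt_symm_of_mem ht).hasMFDerivAt hF.hasMFDerivAt
  have heq : (fun q : M => sp1PowExp X • q) ∘ (extChartAt (𝓡 d) x₀).symm =ᶠ[𝓝 y]
      (extChartAt (𝓡 d) x₀).symm ∘ fun y => actionInChart x₀ (X, y) := by
    have hcont : ContinuousAt ((fun q : M => sp1PowExp X • q) ∘ (extChartAt (𝓡 d) x₀).symm) y :=
      h1.continuousAt
    filter_upwards [hcont.eventually_mem ((isOpen_extChartAt_source x₀).mem_nhds hX)] with z hz
    exact ((extChartAt (𝓡 d) x₀).left_inv hz).symm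
  have h3 := hasMFDerivAt_unique h1 (h2.congr_of_eventuallyEq heq)
  exact (congrArg (fun T => T a) h3).symm

theorem fieldInChart_actionInChart {x₀ : M} {X : Fin k → LieSp1}
    {y : EuclideanSpace ℝ (Fin d)} (hy : y ∈ (extChartAt (𝓡 d) x₀).target)
    (hX : sp1PowExp X • (extChartAt (𝓡 d) x₀).symm y ∈ (extChartAt (𝓡 d) x₀).source)
    (Y : Fin k → LieSp1) :
    fieldInChart x₀ Y (actionInChart x₀ (X, y)) = fderiv ℝ (actionInChart x₀) (X, y)
      (0, fieldInChart x₀ (sp1PowConj (sp1PowExp X) Y) y) := by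
  have ht : actionInChart x₀ (X, y) ∈ (extChartAt (𝓡 d) x₀).target :=
    (extChartAt (𝓡 d) x₀).map_source hX
  apply mfderiv_extChartAt_symm_injective ht
  rw [mfderiv_symm_comp_fderiv_actionInChart hy hX, ← fundamentalField_extChartAt_symm _ ht,
    ← fundamentalField_extChartAt_symm _ hy, ← fundamentalField_smul]
  have : (extChartAt (𝓡 d) x₀).symm (actionInChart x₀ (X, y)) =
      sp1PowExp X • (extChartAt (𝓡 d) x₀).symm y := (extChartAt (𝓡 d) x₀).left_inv hX
  rw [this]

theorem DiffForm.inChart_actionInChart {n : ℕ} {α : DiffForm d M n}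
    (hα : ∀ (g : Sp1Pow k) (p : M), (α (g • p)).compContinuousLinearMap
      (mfderiv (𝓡 d) (𝓡 d) (fun q : M => g • q) p) = α p)
    {x₀ : M} {X : Fin k → LieSp1}
    {y : EuclideanSpace ℝ (Fin d)} (hy : y ∈ (extChartAt (𝓡 d) x₀).target)
    (hX : sp1PowExp X • (extChartAt (𝓡 d) x₀).symm y ∈ (extChartAt (𝓡 d) x₀).source)
    (a : Fin n → EuclideanSpace ℝ (Fin d)) :
    α.inChart x₀ (actionInChart x₀ (X, y))
        (fun i => fderiv ℝ (actionInChart x₀) (X, y) (0, a i)) =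
      α.inChart x₀ y a := by
  have hL : ∀ (q : M) (u : Fin n → EuclideanSpace ℝ (Fin d)),
      q = sp1PowExp X • (extChartAt (𝓡 d) x₀).symm y →
      (α q : EuclideanSpace ℝ (Fin d) [⋀^Fin n]→L[ℝ] ℝ) u =
        (α (sp1PowExp X • (extChartAt (𝓡 d) x₀).symm y) :
          EuclideanSpace ℝ (Fin d) [⋀^Fin n]→L[ℝ] ℝ) u := by
    rintro q u rfl; rfl
  have h1 := hL _ (fun i => mfderiv 𝓘(ℝ, EuclideanSpace ℝ (Fin d)) (𝓡 d)
    (extChartAt (𝓡 d) x₀).symm (actionInChart x₀ (X, y))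
    (fderiv ℝ (actionInChart x₀) (X, y) (0, a i))) ((extChartAt (𝓡 d) x₀).left_inv hX)
  refine Eq.trans h1 ?_
  simp only [mfderiv_symm_comp_fderiv_actionInChart hy hX]
  have h2 := congrArg (fun T => T fun i => mfderiv 𝓘(ℝ, EuclideanSpace ℝ (Fin d)) (𝓡 d)
    (extChartAt (𝓡 d) x₀).symm y (a i)) (hα (sp1PowExp X) ((extChartAt (𝓡 d) x₀).symm y))
  exact h2

end Coordinates

/-! ### Infinitesimal invariance and closedness of the contractions -/

section Algebra

variable {E : Type*} [NormedAddCommGroup E] [NormedSpace ℝ E]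

namespace ContinuousAlternatingMap

variable (f : E [⋀^Fin 4]→L[ℝ] ℝ) (a b c e : E)

theorem map_vec_swap₀₁ : f ![b, a, c, e] = -f ![a, b, c, e] := by
  refine Eq.trans (congrArg f ?_) (f.toAlternatingMap.map_swap ![a, b, c, e]
    (show (0 : Fin 4) ≠ 1 by decide))
  funext i
  fin_cases i <;> rfl

theorem map_vec_swap₁₂ : f ![a, c, b, e] = -f ![a, b, c, e] := by
  refine Eq.trans (congrArg f ?_) (f.toAlternatingMap.map_swap ![a, b, c, e]
    (show (1 : Fin 4) ≠ 2 by decide))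
  funext i
  fin_cases i <;> rfl

theorem map_vec_swap₂₃ : f ![a, b, e, c] = -f ![a, b, c, e] := by
  refine Eq.trans (congrArg f ?_) (f.toAlternatingMap.map_swap ![a, b, c, e]
    (show (2 : Fin 4) ≠ 3 by decide))
  funext i
  fin_cases i <;> rfl

theorem map_vec_add_smul₀ (r : ℝ) (a' : E) :
    f ![a + r • a', b, c, e] = f ![a, b, c, e] + r * f ![a', b, c, e] := by
  have h1 := (f.curryLeft).map_add a (r • a')
  rw [map_smul] at h1
  exact congrArg (fun T => T ![b, c, e]) h1

theorem map_vec_same₀₁ : f ![a, a, c, e] = 0 :=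
  f.map_eq_zero_of_eq _ (show ![a, a, c, e] 0 = ![a, a, c, e] 1 from rfl) (by decide)

end ContinuousAlternatingMap

theorem fderiv_apply_vec_four {Ω : E → E [⋀^Fin 4]→L[ℝ] ℝ} {X₁ X₂ X₃ : E → E} {y : E}
    (hω : DifferentiableAt ℝ Ω y) (h₁ : DifferentiableAt ℝ X₁ y) (h₂ : DifferentiableAt ℝ X₂ y)
    (h₃ : DifferentiableAt ℝ X₃ y) (u w : E) :
    fderiv ℝ (fun x => Ω x ![X₁ x, X₂ x, X₃ x, w]) y u =
      fderiv ℝ Ω y u ![X₁ y, X₂ y, X₃ y, w] + Ω y ![fderiv ℝ X₁ y u, X₂ y, X₃ y, w] +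
      Ω y ![X₁ y, fderiv ℝ X₂ y u, X₃ y, w] + Ω y ![X₁ y, X₂ y, fderiv ℝ X₃ y u, w] := by
  have hg : ∀ i, DifferentiableAt ℝ (![X₁, X₂, X₃, fun _ => w] i) y := by
    intro i
    fin_cases i
    exacts [h₁, h₂, h₃, differentiableAt_const w]
  have h := fderiv_continuousAlternatingMap_apply_apply hω hg u
  have hv : ∀ x, (fun i => ![X₁, X₂, X₃, fun _ => w] i x) = ![X₁ x, X₂ x, X₃ x, w] := fun x => by
    funext i
    fin_cases i <;> rfl
  simp only [hv, Fin.sum_univ_four] at h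
  have h0 : Ω y (Function.update ![X₁ y, X₂ y, X₃ y, w] 3 0) = 0 :=
    (Ω y).map_coord_zero 3 (by simp)
  have e0 : ∀ z, Function.update ![X₁ y, X₂ y, X₃ y, w] 0 z = ![z, X₂ y, X₃ y, w] := fun z => by
    funext i; fin_cases i <;> rfl
  have e1 : ∀ z, Function.update ![X₁ y, X₂ y, X₃ y, w] 1 z = ![X₁ y, z, X₃ y, w] := fun z => by
    funext i; fin_cases i <;> rfl
  have e2 : ∀ z, Function.update ![X₁ y, X₂ y, X₃ y, w] 2 z = ![X₁ y, X₂ y, z, w] := fun z => by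
    funext i; fin_cases i <;> rfl
  rw [h, e0, e1, e2]
  have h3 : fderiv ℝ (![X₁, X₂, X₃, fun _ => w] 3) y u = 0 := by
    change fderiv ℝ (fun _ : E => w) y u = 0
    simp
  rw [h3, h0, add_zero]
  simp only [add_assoc]
  rfl

theorem sum_update_four (f : E [⋀^Fin 4]→L[ℝ] ℝ) (a b c e : E) (A : E → E) :
    ∑ i, f (Function.update ![a, b, c, e] i (A (![a, b, c, e] i))) =
      f ![A a, b, c, e] + f ![a, A b, c, e] + f ![a, b, A c, e] + f ![a, b, c, A e] := by
  rw [Fin.sum_univ_four]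
  congr 1
  · congr 1
    · congr 1 <;> (congr 1; funext i; fin_cases i <;> rfl)
    · congr 1; funext i; fin_cases i <;> rfl
  · congr 1; funext i; fin_cases i <;> rfl

/-- Let `Ω` be a closed `4`-form whose Lie derivatives along `X₁`, `X₂`, `X₃` vanish, and suppose
that the bracket of any two of these fields is a multiple of the third. Then the `1`-form
`Ω(X₁, X₂, X₃, ·)` is closed. -/
theorem extDeriv_curryLeft_three_eq_zero {Ω : E → E [⋀^Fin 4]→L[ℝ] ℝ} {X₁ X₂ X₃ : E → E} {y : E}
    (hω : DifferentiableAt ℝ Ω y) (h₁ : DifferentiableAt ℝ X₁ y) (h₂ : DifferentiableAt ℝ X₂ y)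
    (h₃ : DifferentiableAt ℝ X₃ y) (hβ : DifferentiableAt ℝ
      (fun x => (((Ω x).curryLeft (X₁ x)).curryLeft (X₂ x)).curryLeft (X₃ x)) y) (hd : extDeriv Ω y = 0)
    (hL₁ : ∀ a, fderiv ℝ Ω y (X₁ y) a + ∑ i, Ω y (Function.update a i (fderiv ℝ X₁ y (a i))) = 0)
    (hL₂ : ∀ a, fderiv ℝ Ω y (X₂ y) a + ∑ i, Ω y (Function.update a i (fderiv ℝ X₂ y (a i))) = 0)
    (hL₃ : ∀ a, fderiv ℝ Ω y (X₃ y) a + ∑ i, Ω y (Function.update a i (fderiv ℝ X₃ y (a i))) = 0)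
    {r₁ r₂ r₃ : ℝ} (hb₁ : fderiv ℝ X₃ y (X₂ y) = fderiv ℝ X₂ y (X₃ y) + r₁ • X₁ y)
    (hb₂ : fderiv ℝ X₃ y (X₁ y) = fderiv ℝ X₁ y (X₃ y) + r₂ • X₂ y)
    (hb₃ : fderiv ℝ X₂ y (X₁ y) = fderiv ℝ X₁ y (X₂ y) + r₃ • X₃ y) :
    extDeriv (fun x => (((Ω x).curryLeft (X₁ x)).curryLeft (X₂ x)).curryLeft (X₃ x)) y = 0 := by
  ext v
  obtain ⟨u, w, rfl⟩ : ∃ u w, v = ![u, w] := ⟨v 0, v 1, by funext i; fin_cases i <;> rfl⟩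
  rw [extDeriv_apply hβ]
  have hv0 : Fin.removeNth 0 ![u, w] = ![w] := by funext i; fin_cases i; rfl
  have hv1 : Fin.removeNth 1 ![u, w] = ![u] := by funext i; fin_cases i; rfl
  rw [Fin.sum_univ_two, hv0, hv1]
  change (-1 : ℤ) ^ 0 • fderiv ℝ (fun x => Ω x ![X₁ x, X₂ x, X₃ x, w]) y u +
    (-1 : ℤ) ^ 1 • fderiv ℝ (fun x => Ω x ![X₁ x, X₂ x, X₃ x, u]) y w = 0
  rw [fderiv_apply_vec_four hω h₁ h₂ h₃, fderiv_apply_vec_four hω h₁ h₂ h₃]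
  have hd' := congrArg (fun T => T ![X₁ y, X₂ y, X₃ y, u, w]) hd
  simp only [extDeriv_apply hω, fderiv_continuousAlternatingMap_apply_const_apply hω] at hd'
  replace hd' : ∑ i : Fin 5, (-1 : ℤ) ^ (i : ℕ) • fderiv ℝ Ω y (![X₁ y, X₂ y, X₃ y, u, w] i)
      (i.removeNth ![X₁ y, X₂ y, X₃ y, u, w]) = 0 := hd'
  -- Each Lie derivative is evaluated on the other two fields and `u, w`, matching a term of `dΩ(X₁,
  -- X₂, X₃, u, w)`.
  have l₁ := hL₁ ![X₂ y, X₃ y, u, w]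
  have l₂ := hL₂ ![X₁ y, X₃ y, u, w]
  have l₃ := hL₃ ![X₁ y, X₂ y, u, w]
  rw [sum_update_four] at l₁ l₂ l₃
  have v0 : Fin.removeNth 0 ![X₁ y, X₂ y, X₃ y, u, w] = ![X₂ y, X₃ y, u, w] := by
    funext i; fin_cases i <;> rfl
  have v1 : Fin.removeNth 1 ![X₁ y, X₂ y, X₃ y, u, w] = ![X₁ y, X₃ y, u, w] := by
    funext i; fin_cases i <;> rfl
  have v2 : Fin.removeNth 2 ![X₁ y, X₂ y, X₃ y, u, w] = ![X₁ y, X₂ y, u, w] := by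
    funext i; fin_cases i <;> rfl
  have v3 : Fin.removeNth 3 ![X₁ y, X₂ y, X₃ y, u, w] = ![X₁ y, X₂ y, X₃ y, w] := by
    funext i; fin_cases i <;> rfl
  have v4 : Fin.removeNth 4 ![X₁ y, X₂ y, X₃ y, u, w] = ![X₁ y, X₂ y, X₃ y, u] := by
    funext i; fin_cases i <;> rfl
  rw [Fin.sum_univ_five, v0, v1, v2, v3, v4] at hd'
  replace hd' : fderiv ℝ Ω y (X₁ y) ![X₂ y, X₃ y, u, w] - fderiv ℝ Ω y (X₂ y) ![X₁ y, X₃ y, u, w] +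
      fderiv ℝ Ω y (X₃ y) ![X₁ y, X₂ y, u, w] - fderiv ℝ Ω y u ![X₁ y, X₂ y, X₃ y, w] +
      fderiv ℝ Ω y w ![X₁ y, X₂ y, X₃ y, u] = 0 := by
    rw [← hd']
    simp [pow_succ]
    ring
  have s := (Ω y).map_vec_swap₀₁
  have s' := (Ω y).map_vec_swap₁₂
  have s'' := (Ω y).map_vec_swap₂₃
  -- `p₁` to `p₅` carry a derivative of `Xⱼ` along `u` or `w` back to the `j`-th slot, where the
  -- Leibniz rule produces it.
  have p₁ : ∀ a b c e, Ω y ![a, b, c, e] = Ω y ![c, a, b, e] := fun a b c e => by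
    rw [s a c, s' a b, neg_neg]
  have p₂ : ∀ a b c e, Ω y ![a, b, c, e] = -Ω y ![e, a, b, c] := fun a b c e => by
    rw [s a e, s' a b, s'' a b c e, neg_neg, neg_neg]
  have p₃ : ∀ a b c e, Ω y ![a, b, c, e] = -Ω y ![a, c, b, e] := fun a b c e => by
    rw [s' a b, neg_neg]
  have p₄ : ∀ a b c e, Ω y ![a, b, c, e] = Ω y ![a, e, b, c] := fun a b c e => by
    rw [s' a b, s'' a b c e, neg_neg]
  have p₅ : ∀ a b c e, Ω y ![a, b, c, e] = -Ω y ![a, b, e, c] := fun a b c e => by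
    rw [s'' a b c e, neg_neg]
  -- In `b₁, b₂, b₃` the bracket correction repeats a vector already present, so the two mixed
  -- derivatives become interchangeable.
  have b₁ : Ω y ![X₁ y, fderiv ℝ X₃ y (X₂ y), u, w] = Ω y ![X₁ y, fderiv ℝ X₂ y (X₃ y), u, w] := by
    rw [hb₁, s (_ + _), s (fderiv ℝ X₂ y (X₃ y)), ContinuousAlternatingMap.map_vec_add_smul₀,
      ContinuousAlternatingMap.map_vec_same₀₁, mul_zero, add_zero]
  have b₂ : Ω y ![fderiv ℝ X₃ y (X₁ y), X₂ y, u, w] =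
      -Ω y ![X₂ y, fderiv ℝ X₁ y (X₃ y), u, w] := by
    rw [hb₂, s (fderiv ℝ X₁ y (X₃ y)), ContinuousAlternatingMap.map_vec_add_smul₀,
      ContinuousAlternatingMap.map_vec_same₀₁, mul_zero, add_zero, neg_neg]
  have b₃ : Ω y ![fderiv ℝ X₂ y (X₁ y), X₃ y, u, w] = Ω y ![fderiv ℝ X₁ y (X₂ y), X₃ y, u, w] := by
    rw [hb₃, ContinuousAlternatingMap.map_vec_add_smul₀,
      ContinuousAlternatingMap.map_vec_same₀₁, mul_zero, add_zero]
  rw [p₁ _ _ (fderiv ℝ X₁ y u), p₂ _ _ _ (fderiv ℝ X₁ y w)] at l₁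
  rw [p₃ _ _ (fderiv ℝ X₂ y u), p₄ _ _ _ (fderiv ℝ X₂ y w), b₃] at l₂
  rw [p₅ _ _ _ (fderiv ℝ X₃ y w), b₁, b₂] at l₃
  simp only [pow_zero, pow_one, one_smul, neg_smul]
  -- The combination is `l₁ - l₂ + l₃ - hd'`; the mixed derivatives cancel in pairs.
  linarith

end Algebra

/-! ### Lie derivatives and brackets of fundamental fields in a chart -/

section Coordinates

variable {d k : ℕ} {M : Type*} [TopologicalSpace M] [ChartedSpace (EuclideanSpace ℝ (Fin d)) M]
  [MulAction (Sp1Pow k) M] [IsManifold (𝓡 d) ∞ M]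
  [ContMDiffSMul (Sp1Pow.model k) (𝓡 d) ∞ (Sp1Pow k) M]

theorem fderiv_actionInChart_zero {x₀ : M} {y : EuclideanSpace ℝ (Fin d)}
    (hy : y ∈ (extChartAt (𝓡 d) x₀).target) (a : EuclideanSpace ℝ (Fin d)) :
    fderiv ℝ (actionInChart x₀) ((0 : Fin k → LieSp1), y) (0, a) = a := by
  have hF : HasFDerivAt (fun y => actionInChart x₀ ((0 : Fin k → LieSp1), y))
      ((fderiv ℝ (actionInChart x₀) ((0 : Fin k → LieSp1), y)).comp
        (ContinuousLinearMap.inr ℝ _ _)) y :=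
    ((contDiffAt_actionInChart_zero hy).differentiableAt (by simp)).hasFDerivAt.comp y
      (hasFDerivAt_prodMk_right _ y)
  have heq : (fun y => actionInChart x₀ ((0 : Fin k → LieSp1), y)) =ᶠ[𝓝 y] id := by
    filter_upwards [(isOpen_extChartAt_target x₀).mem_nhds hy] with z hz
    exact actionInChart_zero hz
  exact congrArg (fun T => T a) (hF.unique ((hasFDerivAt_id y).congr_of_eventuallyEq heq))

/-- Symmetry of second derivatives: the `t`- and `y`-derivatives of the action are exchanged, and
its `t`-derivative at `0` is the field. -/
theorem hasDerivAt_fderiv_actionInChart (X : Fin k → LieSp1) {x₀ : M}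
    {y : EuclideanSpace ℝ (Fin d)} (hy : y ∈ (extChartAt (𝓡 d) x₀).target) :
    HasDerivAt (fun t : ℝ => (fderiv ℝ (actionInChart x₀) (t • X, y)).comp
      (ContinuousLinearMap.inr ℝ (Fin k → LieSp1) (EuclideanSpace ℝ (Fin d))))
      (fderiv ℝ (fieldInChart x₀ X) y) 0 := by
  have hF := contDiffAt_actionInChart_zero (k := k) hy
  have hsymm : IsSymmSndFDerivAt ℝ (actionInChart x₀) ((0 : Fin k → LieSp1), y) :=
    hF.isSymmSndFDerivAt 
      (by simpa only [minSmoothness_of_isRCLikeNormedField] using ENat.LEInfty.out)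
  have hD := ((hF.fderiv_right (m := ∞) (by simp)).differentiableAt (by simp)).hasFDerivAt
  have hZ : HasFDerivAt (fieldInChart x₀ X)
      ((ContinuousLinearMap.apply ℝ _ (X, 0)).comp
        ((fderiv ℝ (fderiv ℝ (actionInChart x₀)) ((0 : Fin k → LieSp1), y)).comp
          (ContinuousLinearMap.inr ℝ _ _))) y :=
    HasFDerivAt.comp (g := ContinuousLinearMap.apply ℝ (EuclideanSpace ℝ (Fin d)) ((X, 0) :
      (Fin k → LieSp1) × EuclideanSpace ℝ (Fin d))) y (ContinuousLinearMap.hasFDerivAt _)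
        (hD.comp y (hasFDerivAt_prodMk_right _ y))
  rw [hZ.fderiv]
  have hD' := hD
  rw [← zero_smul ℝ X] at hD'
  have h1 := hD'.comp_hasDerivAt (0 : ℝ) (hasDerivAt_smul_prodMk X y)
  have h2 := h1.clm_comp (hasDerivAt_const (0 : ℝ)
    (ContinuousLinearMap.inr ℝ (Fin k → LieSp1) (EuclideanSpace ℝ (Fin d))))
  refine h2.congr_deriv ?_
  ext1 a
  simp only [zero_smul, ContinuousLinearMap.comp_zero, add_zero]
  exact hsymm (X, 0) (0, a)

/-- The Lie derivative of an invariant form along a fundamental vector field vanishes. -/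
theorem DiffForm.lieDerivative_inChart_eq_zero {n : ℕ} {α : DiffForm d M n} (hs : α.IsSmooth)
    (hα : ∀ (g : Sp1Pow k) (p : M), (α (g • p)).compContinuousLinearMap
      (mfderiv (𝓡 d) (𝓡 d) (fun q : M => g • q) p) = α p)
    (X : Fin k → LieSp1) {x₀ : M} {y : EuclideanSpace ℝ (Fin d)}
    (hy : y ∈ (extChartAt (𝓡 d) x₀).target) (a : Fin n → EuclideanSpace ℝ (Fin d)) :
    fderiv ℝ (α.inChart x₀) y (fieldInChart x₀ X y) a +
      ∑ i, α.inChart x₀ y (Function.update a i (fderiv ℝ (fieldInChart x₀ X) y (a i))) = 0 := by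
  have hω : HasFDerivAt (α.inChart x₀) (fderiv ℝ (α.inChart x₀) y) y :=
    (((hs x₀).contDiffAt ((isOpen_extChartAt_target x₀).mem_nhds hy)).differentiableAt
      (by simp)).hasFDerivAt
  have h0 : actionInChart x₀ ((0 : ℝ) • X, y) = y := by rw [zero_smul, actionInChart_zero hy]
  have h1 : HasDerivAt (fun t : ℝ => α.inChart x₀ (actionInChart x₀ (t • X, y)))
      (fderiv ℝ (α.inChart x₀) y (fieldInChart x₀ X y)) 0 := by
    rw [← h0] at hω
    refine (hω.comp_hasDerivAt (0 : ℝ) (hasDerivAt_actionInChart X hy)).congr_deriv ?_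
    rw [h0]
  have h2 : ∀ i, HasDerivAt (fun t : ℝ => fderiv ℝ (actionInChart x₀) (t • X, y) (0, a i))
      (fderiv ℝ (fieldInChart x₀ X) y (a i)) 0 := fun i => by
    have h := (hasDerivAt_fderiv_actionInChart X hy).clm_apply (hasDerivAt_const (0 : ℝ) (a i))
    rwa [map_zero, add_zero] at h
  have h3 := (HasFDerivAt.continuousAlternatingMap_apply h1.hasFDerivAt
    fun i => (h2 i).hasFDerivAt).hasDerivAt
  have h4 : (fun t : ℝ => α.inChart x₀ (actionInChart x₀ (t • X, y))
      (fun i => fderiv ℝ (actionInChart x₀) (t • X, y) (0, a i))) =ᶠ[𝓝 0]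
      fun _ => α.inChart x₀ y a := by
    filter_upwards [eventually_exp_smul_mem_source X
      ((extChartAt (𝓡 d) x₀).map_target hy)] with t ht
    exact DiffForm.inChart_actionInChart hα hy ht a
  -- By invariance the differentiated function is constant near `t = 0`.
  have h5 := h3.unique ((hasDerivAt_const (0 : ℝ) _).congr_of_eventuallyEq h4)
  simpa [h0, fderiv_actionInChart_zero hy, actionInChart_zero hy] using h5

/-- Differentiate the equivariance `fieldInChart_actionInChart` at `t = 0` along `exp(tX)`. It says
that `X ↦ X̂` is an antihomomorphism for brackets. -/
theorem fieldInChart_bracket (X Y : Fin k → LieSp1) {x₀ : M} {y : EuclideanSpace ℝ (Fin d)}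
    (hy : y ∈ (extChartAt (𝓡 d) x₀).target) :
    fderiv ℝ (fieldInChart x₀ Y) y (fieldInChart x₀ X y) =
      fderiv ℝ (fieldInChart x₀ X) y (fieldInChart x₀ Y y) +
        fieldInChart x₀ (fun i => sp1Comm (Y i) (X i)) y := by
  have hZ : HasFDerivAt (fieldInChart x₀ Y) (fderiv ℝ (fieldInChart x₀ Y) y) y :=
    (((contDiffOn_fieldInChart x₀ Y).contDiffAt
      ((isOpen_extChartAt_target x₀).mem_nhds hy)).differentiableAt (by simp)).hasFDerivAt
  have h0 : actionInChart x₀ ((0 : ℝ) • X, y) = y := by rw [zero_smul, actionInChart_zero hy]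
  have h1 : HasDerivAt (fun t : ℝ => fieldInChart x₀ Y (actionInChart x₀ (t • X, y)))
      (fderiv ℝ (fieldInChart x₀ Y) y (fieldInChart x₀ X y)) 0 := by
    rw [← h0] at hZ
    refine (hZ.comp_hasDerivAt (0 : ℝ) (hasDerivAt_actionInChart X hy)).congr_deriv ?_
    rw [h0]
  have h2 : HasDerivAt (fun t : ℝ => fieldInChart x₀ (sp1PowConj (sp1PowExp (t • X)) Y) y)
      (fieldInChart x₀ (fun i => sp1Comm (Y i) (X i)) y) 0 :=
    (((fderiv ℝ (actionInChart x₀) ((0 : Fin k → LieSp1), y)).comp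
      (ContinuousLinearMap.inl ℝ _ _)).hasFDerivAt).comp_hasDerivAt (0 : ℝ)
        (hasDerivAt_sp1PowConj_exp X Y)
  have h3 := (hasDerivAt_fderiv_actionInChart X hy).clm_apply h2
  have h4 : (fun t : ℝ => fieldInChart x₀ Y (actionInChart x₀ (t • X, y))) =ᶠ[𝓝 0]
      fun t => ((fderiv ℝ (actionInChart x₀) (t • X, y)).comp
        (ContinuousLinearMap.inr ℝ (Fin k → LieSp1) (EuclideanSpace ℝ (Fin d))))
        (fieldInChart x₀ (sp1PowConj (sp1PowExp (t • X)) Y) y) := by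
    filter_upwards [eventually_exp_smul_mem_source X
      ((extChartAt (𝓡 d) x₀).map_target hy)] with t ht
    exact fieldInChart_actionInChart hy ht Y
  have h5 := h1.unique (h3.congr_of_eventuallyEq h4)
  have h6 : sp1PowConj (1 : Sp1Pow k) Y = Y := by
    funext i
    exact Subtype.ext (by simp [sp1PowConj, coe_sp1Conj])
  simpa [sp1PowExp_zero, h6, fderiv_actionInChart_zero hy] using h5

end Coordinates

/-! ### The tri-moment map -/

section TriMoment

variable {d k : ℕ} {M : Type*} [TopologicalSpace M] [ChartedSpace (EuclideanSpace ℝ (Fin d)) M]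

theorem DiffForm.inChart_apply_nil (η : DiffForm d M 0) (x₀ : M)
    (y : EuclideanSpace ℝ (Fin d)) :
    η.inChart x₀ y ![] = η ((extChartAt (𝓡 d) x₀).symm y) ![] :=
  congrArg (η ((extChartAt (𝓡 d) x₀).symm y)) (Subsingleton.elim _ _)

theorem DiffForm.apply_nil_eventuallyEq (η : DiffForm d M 0) (p : M) :
    (fun q => η q ![]) =ᶠ[𝓝 p] (fun y => η.inChart p y ![]) ∘ extChartAt (𝓡 d) p := by
  filter_upwards [extChartAt_source_mem_nhds (I := 𝓡 d) p] with q hq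
  rw [Function.comp_apply, η.inChart_apply_nil, (extChartAt (𝓡 d) p).left_inv hq]

theorem DiffForm.IsSmooth.contDiffAt_inChart_apply {n : ℕ} {α : DiffForm d M n} (hα : α.IsSmooth)
    (p : M) (v : Fin n → EuclideanSpace ℝ (Fin d)) :
    ContDiffAt ℝ ∞ (fun y => α.inChart p y v) (extChartAt (𝓡 d) p p) :=
  (ContinuousAlternatingMap.apply ℝ (EuclideanSpace ℝ (Fin d)) ℝ v).contDiff.contDiffAt.comp _
    ((hα p).contDiffAt (extChartAt_target_mem_nhds p))

theorem DiffForm.IsSmooth.contMDiff_apply_nil [IsManifold (𝓡 d) ∞ M] {η : DiffForm d M 0}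
    (hη : η.IsSmooth) : ContMDiff (𝓡 d) 𝓘(ℝ, ℝ) ∞ (fun p => η p ![]) := fun p =>
  ((hη.contDiffAt_inChart_apply p ![]).contMDiffAt.comp p
    contMDiffAt_extChartAt).congr_of_eventuallyEq (η.apply_nil_eventuallyEq p)

theorem DiffForm.mfderiv_apply_nil [IsManifold (𝓡 d) ∞ M] {η : DiffForm d M 0}
    (hη : η.IsSmooth) (p : M) (v : TangentSpace (𝓡 d) p) :
    mfderiv (𝓡 d) 𝓘(ℝ, ℝ) (fun q => η q ![]) p v = η.extD p ![v] := by
  have h1 := ((hη.contDiffAt_inChart_apply p ![]).differentiableAt (by simp)).hasFDerivAt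
  have h2 : MDifferentiableAt (𝓡 d) 𝓘(ℝ, EuclideanSpace ℝ (Fin d)) (extChartAt (𝓡 d) p) p :=
    (contMDiffAt_extChartAt (n := ∞)).mdifferentiableAt (by simp)
  have h3 := (h1.hasMFDerivAt.comp p h2.hasMFDerivAt).congr_of_eventuallyEq
    (η.apply_nil_eventuallyEq p)
  rw [h3.mfderiv]
  let w : EuclideanSpace ℝ (Fin d) :=
    mfderiv (𝓡 d) 𝓘(ℝ, EuclideanSpace ℝ (Fin d)) (extChartAt (𝓡 d) p) p v
  have h4 : extDeriv (η.inChart p) (extChartAt (𝓡 d) p p) ![w] =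
      fderiv ℝ (fun y => η.inChart p y ![]) (extChartAt (𝓡 d) p p) w := by
    rw [extDeriv_apply (hη.differentiableAt p)]
    have hv : Fin.removeNth 0 ![w] = ![] := Subsingleton.elim _ _
    simp [hv]
  refine h4.symm.trans ?_
  change _ = extDeriv (η.inChart p) (extChartAt (𝓡 d) p p) (fun i => _)
  congr 1
  funext i
  fin_cases i
  rfl

/-- A coordinate ball is convex, so a vanishing derivative there gives constancy. -/
theorem isLocallyConstant_of_mfderiv_eq_zero [IsManifold (𝓡 d) ∞ M] {f : M → ℝ}
    (hf : ∀ p, HasMFDerivAt (𝓡 d) 𝓘(ℝ, ℝ) f p 0) : IsLocallyConstant f := by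
  rw [IsLocallyConstant.iff_eventually_eq]
  intro p
  obtain ⟨ε, hε, hball⟩ := Metric.mem_nhds_iff.1 (extChartAt_target_mem_nhds (I := 𝓡 d) p)
  have hF : ∀ y ∈ Metric.ball (extChartAt (𝓡 d) p p) ε,
      HasFDerivAt (f ∘ (extChartAt (𝓡 d) p).symm)
        (0 : EuclideanSpace ℝ (Fin d) →L[ℝ] ℝ) y := fun y hy => by
    have h := (hf ((extChartAt (𝓡 d) p).symm y)).comp y
      (mdifferentiableAt_extChartAt_symm_of_mem (hball hy)).hasMFDerivAt
    exact (hasMFDerivAt_iff_hasFDerivAt.1 h).congr_fderiv (by ext; rfl)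
  filter_upwards [extChartAt_source_mem_nhds (I := 𝓡 d) p,
    (continuousAt_extChartAt (I := 𝓡 d) p).eventually_mem (Metric.ball_mem_nhds _ hε)] with q hq hqb
  have h := (convex_ball (extChartAt (𝓡 d) p p) ε).is_const_of_fderivWithin_eq_zero (𝕜 := ℝ)
    (fun y hy => (hF y hy).differentiableAt.differentiableWithinAt)
    (fun y hy => (hF y hy).hasFDerivWithinAt.fderivWithin
      (Metric.isOpen_ball.uniqueDiffWithinAt hy)) hqb (Metric.mem_ball_self hε)
  simpa only [Function.comp_apply, (extChartAt (𝓡 d) p).left_inv hq,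
    extChartAt_to_inv] using h

theorem exists_extD_eq_of_bettiNumber_eq_zero {n : ℕ} (hb : bettiNumber d M (n + 1) = 0)
    {α : DiffForm d M (n + 1)} (hα : α.IsSmooth) (hd : α.extD = 0) :
    ∃ η : DiffForm d M n, η.IsSmooth ∧ η.extD = α := by
  have h : Subsingleton (DeRhamCohomology d M (n + 1)) := rank_zero_iff.1 hb
  exact (Submodule.Quotient.mk_eq_zero _).1
    (Subsingleton.elim (Submodule.Quotient.mk (⟨α, hα, hd⟩ : closedForms d M (n + 1)) :
      DeRhamCohomology d M (n + 1)) 0)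

variable [MulAction (Sp1Pow k) M]

/-- The `1`-form `ψ(Û, V̂, Ŵ, ·)`. -/
def tripleContraction (ψ : DiffForm d M 4) (U V W : Fin k → LieSp1) : DiffForm d M 1 :=
  ((ψ.contract (fundamentalField U)).contract (fundamentalField V)).contract (fundamentalField W)

theorem tripleContraction_apply (ψ : DiffForm d M 4) (U V W : Fin k → LieSp1) (p : M)
    (v : TangentSpace (𝓡 d) p) :
    tripleContraction ψ U V W p ![v] =
      ψ p ![fundamentalField U p, fundamentalField V p, fundamentalField W p, v] := rfl

variable [IsManifold (𝓡 d) ∞ M] [ContMDiffSMul (Sp1Pow.model k) (𝓡 d) ∞ (Sp1Pow k) M]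

/-- `extD` at `p` is read in the chart centred at `p`, whose differential is onto, so no tuple of
vectors is missed. -/
theorem DiffForm.extDeriv_inChart_eq_zero {n : ℕ} {α : DiffForm d M n} (hα : α.extD = 0) (p : M) :
    extDeriv (α.inChart p) (extChartAt (𝓡 d) p p) = 0 := by
  ext v
  choose w hw using fun i => mfderiv_extChartAt_surjective (d := d) p (v i)
  have h := congrArg (fun T : DiffForm d M (n + 1) => T p w) hα
  change extDeriv (α.inChart p) (extChartAt (𝓡 d) p p) (fun i => _) = 0 at h
  rw [← funext hw]
  exact h

theorem fieldInChart_bracket_single (i : Fin k) {X Y Z : LieSp1} {r : ℝ}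
    (h : sp1Comm Y X = r • Z) {x₀ : M} {y : EuclideanSpace ℝ (Fin d)}
    (hy : y ∈ (extChartAt (𝓡 d) x₀).target) :
    fderiv ℝ (fieldInChart x₀ (Pi.single i Y)) y (fieldInChart x₀ (Pi.single i X) y) =
      fderiv ℝ (fieldInChart x₀ (Pi.single i X)) y (fieldInChart x₀ (Pi.single i Y) y) +
        r • fieldInChart x₀ (Pi.single i Z) y := by
  have hc : (fun j => sp1Comm ((Pi.single i Y : Fin k → LieSp1) j)
      ((Pi.single i X : Fin k → LieSp1) j)) = r • Pi.single i Z := by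
    funext j
    by_cases hj : j = i
    · subst hj; simp [h]
    · simp only [Pi.single_eq_of_ne hj, Pi.smul_apply, smul_zero]
      exact Subtype.ext (by simp [sp1Comm])
  rw [fieldInChart_bracket _ _ hy, hc]
  congr 1
  rw [fieldInChart, fieldInChart, ← map_smul, Prod.smul_mk, smul_zero]

theorem tripleContraction_isSmooth {ψ : DiffForm d M 4} (hψ : ψ.IsSmooth)
    (U V W : Fin k → LieSp1) : (tripleContraction ψ U V W).IsSmooth :=
  ((hψ.contract_fundamentalField U).contract_fundamentalField V).contract_fundamentalField W

theorem tripleContraction_closed {ψ : DiffForm d M 4} (hs : ψ.IsSmooth) (hd : ψ.extD = 0)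
    (hinv : ∀ (g : Sp1Pow k) (p : M), (ψ (g • p)).compContinuousLinearMap
      (mfderiv (𝓡 d) (𝓡 d) (fun q : M => g • q) p) = ψ p) (i : Fin k) :
    (tripleContraction ψ (Pi.single i sp1E₁) (Pi.single i sp1E₂)
      (Pi.single i sp1E₃)).extD = 0 := by
  funext p
  have hy := mem_extChartAt_target (I := 𝓡 d) p
  have hX : ∀ X : Fin k → LieSp1, DifferentiableAt ℝ (fieldInChart p X) (extChartAt (𝓡 d) p p) :=
    fun X => ((contDiffOn_fieldInChart p X).contDiffAt
      (extChartAt_target_mem_nhds p)).differentiableAt (by simp)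
  have heq : (tripleContraction ψ (Pi.single i sp1E₁) (Pi.single i sp1E₂)
      (Pi.single i sp1E₃)).inChart p =ᶠ[𝓝 (extChartAt (𝓡 d) p p)] fun y =>
      (((ψ.inChart p y).curryLeft (fieldInChart p (Pi.single i sp1E₁) y)).curryLeft
        (fieldInChart p (Pi.single i sp1E₂) y)).curryLeft
          (fieldInChart p (Pi.single i sp1E₃) y) := by
    filter_upwards [extChartAt_target_mem_nhds p] with y hy
    rw [tripleContraction, DiffForm.inChart_contract_fundamentalField _ _ hy,
      DiffForm.inChart_contract_fundamentalField _ _ hy,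
      DiffForm.inChart_contract_fundamentalField _ _ hy]
  have h := extDeriv_curryLeft_three_eq_zero (hs.differentiableAt p) (hX (Pi.single i sp1E₁))
    (hX (Pi.single i sp1E₂)) (hX (Pi.single i sp1E₃))
    (((tripleContraction_isSmooth hs _ _ _).differentiableAt p).congr_of_eventuallyEq heq.symm)
    (DiffForm.extDeriv_inChart_eq_zero hd p)
    (DiffForm.lieDerivative_inChart_eq_zero hs hinv _ hy)
    (DiffForm.lieDerivative_inChart_eq_zero hs hinv _ hy)
    (DiffForm.lieDerivative_inChart_eq_zero hs hinv _ hy)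
    (fieldInChart_bracket_single i sp1Comm_E₃_E₂ hy)
    (fieldInChart_bracket_single i sp1Comm_E₃_E₁ hy)
    (fieldInChart_bracket_single i sp1Comm_E₂_E₁ hy)
  rw [DiffForm.extD, heq.extDeriv_eq, h]
  rfl

theorem tripleContraction_eq_smul (ψ : DiffForm d M 4) (i : Fin k) (U V W : LieSp1) (p : M)
    (v : TangentSpace (𝓡 d) p) :
    ψ p ![fundamentalField (Pi.single i U) p, fundamentalField (Pi.single i V) p,
        fundamentalField (Pi.single i W) p, v] =
      tripleProduct ![U, V, W] * ψ p ![fundamentalField (Pi.single i sp1E₁) p,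
        fundamentalField (Pi.single i sp1E₂) p, fundamentalField (Pi.single i sp1E₃) p, v] := by
  obtain ⟨L, hL⟩ := exists_fundamentalField_linear (d := d) (k := k) p
  let ψp : EuclideanSpace ℝ (Fin d) [⋀^Fin 4]→L[ℝ] ℝ := ψ p
  let v' : EuclideanSpace ℝ (Fin d) := v
  -- `curryLeft` puts `v` first; bringing it there from the last slot takes three transpositions,
  -- hence the sign.
  let f : LieSp1 [⋀^Fin 3]→ₗ[ℝ] ℝ :=
    (-((ψp.toAlternatingMap.curryLeft v').compLinearMap
      (L ∘ₗ LinearMap.single ℝ (fun _ => LieSp1) i)))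
  have hf : ∀ U V W : LieSp1, ψ p ![fundamentalField (Pi.single i U) p,
      fundamentalField (Pi.single i V) p, fundamentalField (Pi.single i W) p, v] =
      f ![U, V, W] := fun U V W => by
    have hv : ![v', L (Pi.single i U), L (Pi.single i V), L (Pi.single i W)] =
        Matrix.vecCons v' fun j => L (Pi.single i (![U, V, W] j)) := by
      funext j; fin_cases j <;> rfl
    have h1 : ψp ![L (Pi.single i U), L (Pi.single i V), L (Pi.single i W), v'] =
        -ψp ![v', L (Pi.single i U), L (Pi.single i V), L (Pi.single i W)] := by
      rw [ψp.map_vec_swap₀₁ (L (Pi.single i U)), ψp.map_vec_swap₁₂ _ (L (Pi.single i V)),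
        ψp.map_vec_swap₂₃ _ _ (L (Pi.single i W)), neg_neg, neg_neg]
    rw [hv] at h1
    rw [hL, hL, hL]
    exact h1
  rw [hf, hf]
  exact alternatingMap_sp1_eq f _

/-- Moving `g` across replaces each basis vector by its `Ad(g⁻¹)` image, and the triple product of
these images is still `1`. -/
theorem tripleContraction_invariant {ψ : DiffForm d M 4}
    (hinv : ∀ (g : Sp1Pow k) (p : M), (ψ (g • p)).compContinuousLinearMap
      (mfderiv (𝓡 d) (𝓡 d) (fun q : M => g • q) p) = ψ p) (i : Fin k) (g : Sp1Pow k) (p : M)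
    (v : TangentSpace (𝓡 d) p) :
    tripleContraction ψ (Pi.single i sp1E₁) (Pi.single i sp1E₂) (Pi.single i sp1E₃) (g • p)
        ![mfderiv (𝓡 d) (𝓡 d) (fun q : M => g • q) p v] =
      tripleContraction ψ (Pi.single i sp1E₁) (Pi.single i sp1E₂) (Pi.single i sp1E₃) p ![v] := by
  rw [tripleContraction_apply, tripleContraction_apply, fundamentalField_smul,
    fundamentalField_smul, fundamentalField_smul, sp1PowConj_single, sp1PowConj_single,
    sp1PowConj_single]
  have h := congrArg (fun T => T ![fundamentalField (d := d) (Pi.single i (sp1Conj (g i) sp1E₁)) p,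
    fundamentalField (d := d) (Pi.single i (sp1Conj (g i) sp1E₂)) p,
    fundamentalField (d := d) (Pi.single i (sp1Conj (g i) sp1E₃)) p, v]) (hinv g p)
  have h2 := tripleContraction_eq_smul ψ i (sp1Conj (g i) sp1E₁) (sp1Conj (g i) sp1E₂)
    (sp1Conj (g i) sp1E₃) p v
  rw [tripleProduct_conj, tripleProduct_basis, one_mul] at h2
  rw [← h2]
  refine Eq.trans ?_ h
  refine congrArg (ψ (g • p)) ?_
  funext j
  fin_cases j <;> rfl

/-- A function whose differential is invariant under the action is itself invariant, since
`Sp(1)^k` is compact and connected. -/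
theorem smul_eq_of_mfderiv_invariant {f : M → ℝ} (hf : ContMDiff (𝓡 d) 𝓘(ℝ, ℝ) ∞ f)
    (hinv : ∀ (g : Sp1Pow k) (p : M) (v : TangentSpace (𝓡 d) p),
      mfderiv (𝓡 d) 𝓘(ℝ, ℝ) f (g • p) (mfderiv (𝓡 d) (𝓡 d) (fun q : M => g • q) p v) =
        mfderiv (𝓡 d) 𝓘(ℝ, ℝ) f p v) (g : Sp1Pow k) (p : M) : f (g • p) = f p := by
  have := ContMDiffSMul.continuousSMul (I := Sp1Pow.model k) (I' := 𝓡 d) (G := Sp1Pow k) (M := M) ∞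
  have hfd : ∀ q, MDifferentiableAt (𝓡 d) 𝓘(ℝ, ℝ) f q := hf.mdifferentiable (by simp)
  have hg : MDifferentiable (𝓡 d) (𝓡 d) (fun q : M => g • q) :=
    (ContMDiffSMul.contMDiff_const_smul (I := Sp1Pow.model k) (n := ∞) g).mdifferentiable (by simp)
  have hconst : IsLocallyConstant fun q => f (g • q) - f q := by
    refine isLocallyConstant_of_mfderiv_eq_zero (d := d) fun q => ?_
    have h := ((hfd (g • q)).hasMFDerivAt.comp q (hg q).hasMFDerivAt).sub (hfd q).hasMFDerivAt
    refine h.congr_mfderiv ?_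
    ext v
    exact sub_eq_zero.2 (hinv g q v)
  -- `M` need not be connected, so the difference is pulled back to the connected group along the
  -- orbit map.
  have horbit : ∀ h : Sp1Pow k, f (g • h • p) - f (h • p) = f (g • p) - f p := fun h => by
    have hc : IsLocallyConstant fun h : Sp1Pow k => f (g • h • p) - f (h • p) :=
      hconst.comp_continuous (f := fun h : Sp1Pow k => h • p) (by fun_prop)
    simpa only [one_smul] using hc.apply_eq_of_preconnectedSpace h 1
  have hpow : ∀ n : ℕ, f (g ^ n • p) = f p + n * (f (g • p) - f p) := fun n => by
    induction n with
    | zero => simp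
    | succ n ih =>
      have h := horbit (g ^ n)
      rw [pow_succ', mul_smul g (g ^ n) p]
      push_cast
      linarith
  have hfc : Continuous fun h : Sp1Pow k => f (h • p) :=
    hf.continuous.comp (by fun_prop)
  obtain ⟨C, hC⟩ := (isCompact_range hfc).isBounded.exists_norm_le
  by_contra hne
  have hne' : 0 < |f (g • p) - f p| := abs_pos.2 (sub_ne_zero.2 hne)
  -- With such an `n`, the drift `n |f(gp) - f(p)|` exceeds `C + |f p|`, against the bound `C` on
  -- the compact orbit.
  obtain ⟨n, hn⟩ := exists_nat_gt ((C + |f p|) / |f (g • p) - f p|)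
  rw [div_lt_iff₀ hne'] at hn
  have h1 : |f (g ^ n • p)| ≤ C := hC _ ⟨g ^ n, rfl⟩
  have h2 : (n : ℝ) * |f (g • p) - f p| = |f (g ^ n • p) - f p| := by
    rw [hpow n, add_sub_cancel_left, abs_mul, Nat.abs_cast]
  have h3 := abs_sub (f (g ^ n • p)) (f p)
  linarith

end TriMoment

end

/-! ### Assembly of the tri-moment map -/

theorem mainTheorem9 {m k : ℕ} {M : Type*} [TopologicalSpace M] [T2Space M]
    [SecondCountableTopology M] [ChartedSpace (EuclideanSpace ℝ (Fin (4 * m))) M]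
    [IsManifold (𝓡 (4 * m)) ∞ M] [MulAction (Sp1Pow k) M]
    [ContMDiffSMul (Sp1Pow.model k) (𝓡 (4 * m)) ∞ (Sp1Pow k) M]
    (ψ : DiffForm (4 * m) M 4) (hψ : IsFourPlectic ψ) (hham : IsGeneralizedHamiltonian k ψ)
    (hb : bettiNumber (4 * m) M 1 = 0) :
    ∃ σ : M → Module.Dual ℝ (Fin k → ⋀[ℝ]^3 LieSp1), IsTriMomentMap k ψ σ := by
  have hinv := hham.preserves
  choose η hη hdη using fun i => exists_extD_eq_of_bettiNumber_eq_zero hb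
    (tripleContraction_isSmooth hψ.smooth (Pi.single i sp1E₁) (Pi.single i sp1E₂)
      (Pi.single i sp1E₃)) (tripleContraction_closed (k := k) hψ.smooth hψ.closed hinv i)
  have hmf : ∀ (i : Fin k) (p : M) (v : TangentSpace (𝓡 (4 * m)) p),
      mfderiv (𝓡 (4 * m)) 𝓘(ℝ, ℝ) (fun q => η i q ![]) p v =
        tripleContraction ψ (Pi.single i sp1E₁) (Pi.single i sp1E₂) (Pi.single i sp1E₃) p ![v] :=
    fun i p v => by rw [DiffForm.mfderiv_apply_nil (hη i), hdη i]
  let τ : ⋀[ℝ]^3 LieSp1 →ₗ[ℝ] ℝ := exteriorPower.alternatingMapLinearEquiv tripleProduct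
  have hτ : ∀ U V W : LieSp1, τ (exteriorPower.ιMulti ℝ 3 ![U, V, W]) = tripleProduct ![U, V, W] :=
    fun U V W => exteriorPower.alternatingMapLinearEquiv_apply_ιMulti _ _
  let σ : M → Module.Dual ℝ (Fin k → ⋀[ℝ]^3 LieSp1) := fun p =>
    ∑ i, (η i p ![]) • (τ ∘ₗ LinearMap.proj i)
  have hσ : ∀ p δ, σ p δ = ∑ i, τ (δ i) * η i p ![] := fun p δ => by
    simp [σ, mul_comm]
  have hdiff : ∀ i, ContMDiff (𝓡 (4 * m)) 𝓘(ℝ, ℝ) ∞ (fun q => η i q ![]) :=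
    fun i => (hη i).contMDiff_apply_nil
  refine ⟨σ, ?_, ?_, ?_⟩
  · intro δ
    simp only [hσ]
    exact contMDiff_finsetSum fun i _ => contMDiff_const.mul (hdiff i)
  · intro g p
    refine LinearMap.ext fun δ => ?_
    rw [hσ, hσ]
    refine Finset.sum_congr rfl fun i _ => ?_
    rw [smul_eq_of_mfderiv_invariant (f := fun q => η i q ![]) (hdiff i) ?_ g p]
    intro g p v
    rw [hmf, hmf, tripleContraction_invariant hinv]
  · intro U V W p v
    have hfun : (fun q => σ q (triVector U V W)) =
        ∑ i, (tripleProduct ![U i, V i, W i]) • fun q => η i q ![] := by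
      funext q
      rw [hσ, Finset.sum_apply]
      exact Finset.sum_congr rfl fun i _ => by rw [triVector, hτ]; rfl
    have hD := HasMFDerivAt.sum (t := Finset.univ) fun (i : Fin k) _ =>
      (((hdiff i).mdifferentiable (by simp) p).hasMFDerivAt).const_smul
        (tripleProduct ![U i, V i, W i])
    have hsum : ∀ (T : Fin k → EuclideanSpace ℝ (Fin (4 * m)) →L[ℝ] ℝ)
        (w : EuclideanSpace ℝ (Fin (4 * m))), (∑ i, T i) w = ∑ i, T i w := fun T w => by simp
    rw [hfun, hD.mfderiv]
    refine (hsum _ _).trans (Finset.sum_congr rfl fun i _ => ?_)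
    rw [tripleContraction_eq_smul ψ i (U i) (V i) (W i) p v]
    exact congrArg (tripleProduct ![U i, V i, W i] * ·) (hmf i p v)
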